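/- All algebras are complex and associative, not necessarily unital; a normed algebra has a submultiplicative norm and need not be complete; ideals are two-sided (linear subspaces), not necessarily closed; ideals and subalgebras of a normed algebra carry the inherited norm, and quotients by closed ideals the quotient norm. For a family $M=(a_i)_{i\in\mathbb N}$ in a normed algebra $A$ put $\|M\|_+=\sum_i\|a_i\|$; $M$ is summable if $\|M\|_+<\infty$. The product of $(a_i)$ and $(b_j)$ is the family $(a_ib_j)_{(i,j)}$, which defines the powers $M^n$, $n\ge 1$, and $\rho_t(M)=\inf_{n\ge1}\|M^n\|_+^{1/n}$. The tensor Jacobson radical $\mathcal R_t(A)$ is the set (in fact an ideal) of all $a\in A$ such that $\rho_t(\{a\}\sqcup M)=\rho_t(M)$ for every summable family $M$ in $A$, where $\{a\}\sqcup M$ is the disjoint union of the families. Its centralization $\mathcal R_t^a(A)$ is the preimage, under the quotient map $A\to A/\mathcal R_t(A)$, of the sum of all commutative ideals of $A/\mathcal R_t(A)$. A topological radical on the class $\mathfrak U_{\mathrm n}$ of all normed algebras is a map $P$ that assigns to each normed algebra $A$ a closed ideal $P(A)$ such that (1) $f(P(A))\subset P(B)$ for every open continuous surjective homomorphism $f:A\to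 B$ of normed algebras; (2) $P(A/P(A))=0$; (3) $P(P(A))=P(A)$; (4) for every ideal $I$ of $A$, $P(I)$ is an ideal of $A$ contained in $P(A)$. It is uniform if every subalgebra $B$ of a normed algebra $A$ with $P(A)=A$ satisfies $P(B)=B$. It is regular if it is hereditary, that is $P(I)=I\cap P(A)$ for every ideal $I$ of every normed algebra $A$, and $P(A)=A\cap P(\widehat A)$ for every normed algebra $A$, where $\widehat A$ is the completion of $A$. Theorem. $\mathcal R_t^a$ is a uniform regular topological radical on $\mathfrak U_{\mathrm n}$. Moreover, for every normed algebra $A$, $\mathcal R_t^a(A)$ is the largest among the ideals $J$ of $A$ that are commutative modulo $\mathcal R_t(A)$, i.e. such that $xy-yx\in\mathcal R_t(A)$ for all $x,y\in J$. -/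

import Mathlib

open scoped ENNReal

universe u

set_option linter.unusedSectionVars false

namespace NormedRadical

/-- A two-sided ideal of a (not necessarily unital) complex associative algebra: a linear subspace
stable under left and right multiplication by arbitrary elements. -/
structure AlgIdeal (A : Type u) [NonUnitalRing A] [Module ℂ A] extends Submodule ℂ A where
  mul_mem_left : ∀ (a : A) {x : A}, x ∈ carrier → a * x ∈ carrier
  mul_mem_right : ∀ (a : A) {x : A}, x ∈ carrier → x * a ∈ carrier

namespace AlgIdeal

section Algebraic

variable {A : Type u} [NonUnitalRing A] [Module ℂ A]

instance : SetLike (AlgIdeal A) A where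
  coe I := I.carrier
  coe_injective I J h := by
    obtain ⟨I, _, _⟩ := I
    obtain ⟨J, _, _⟩ := J
    have : I = J := SetLike.coe_injective h
    subst this
    rfl

instance : PartialOrder (AlgIdeal A) := PartialOrder.ofSetLike (AlgIdeal A) A

/-- The zero ideal. -/
instance : Bot (AlgIdeal A) where
  bot :=
    { toSubmodule := ⊥
      mul_mem_left := fun a x hx => by
        have h : x = 0 := hx
        subst h
        exact (mul_zero a : a * 0 = 0)
      mul_mem_right := fun a x hx => by
        have h : x = 0 := hx
        subst h
        exact (zero_mul a : 0 * a = 0) }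

/-- The algebra as an ideal of itself. -/
instance : Top (AlgIdeal A) where
  top :=
    { toSubmodule := ⊤
      mul_mem_left := fun _ _ _ => trivial
      mul_mem_right := fun _ _ _ => trivial }

/-- The underlying (non-unital) subalgebra of an ideal; through it an ideal is an algebra, and an
ideal of a normed algebra is a normed algebra with the inherited norm. -/
def toSubalgebra (I : AlgIdeal A) : NonUnitalSubalgebra ℂ A where
  __ := I.toSubmodule
  mul_mem' {a _} _ hb := I.mul_mem_left a hb

/-- The quotient algebra `A / I`. -/
abbrev Quotient (I : AlgIdeal A) : Type u := A ⧸ I.toSubmodule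

theorem rel_mul (I : AlgIdeal A) {a a' b b' : A} (ha : I.toSubmodule.quotientRel a a')
    (hb : I.toSubmodule.quotientRel b b') : I.toSubmodule.quotientRel (a * b) (a' * b') := by
  rw [Submodule.quotientRel_def] at *
  have h : a * b - a' * b' = (a - a') * b + a' * (b - b') := by
    rw [sub_mul, mul_sub]; abel
  rw [h]
  exact I.toSubmodule.add_mem (I.mul_mem_right b ha) (I.mul_mem_left a' hb)

instance (I : AlgIdeal A) : Mul I.Quotient where
  mul := Quotient.map₂ (· * ·) fun _ _ ha _ _ hb => I.rel_mul ha hb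

instance (I : AlgIdeal A) : NonUnitalRing I.Quotient where
  left_distrib := by
    rintro ⟨a⟩ ⟨b⟩ ⟨c⟩
    exact congrArg (Submodule.Quotient.mk (p := I.toSubmodule)) (mul_add a b c)
  right_distrib := by
    rintro ⟨a⟩ ⟨b⟩ ⟨c⟩
    exact congrArg (Submodule.Quotient.mk (p := I.toSubmodule)) (add_mul a b c)
  zero_mul := by
    rintro ⟨a⟩
    exact congrArg (Submodule.Quotient.mk (p := I.toSubmodule)) (zero_mul a)
  mul_zero := by
    rintro ⟨a⟩
    exact congrArg (Submodule.Quotient.mk (p := I.toSubmodule)) (mul_zero a)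
  mul_assoc := by
    rintro ⟨a⟩ ⟨b⟩ ⟨c⟩
    exact congrArg (Submodule.Quotient.mk (p := I.toSubmodule)) (mul_assoc a b c)

instance [IsScalarTower ℂ A A] (I : AlgIdeal A) : IsScalarTower ℂ I.Quotient I.Quotient where
  smul_assoc := by
    rintro c ⟨a⟩ ⟨b⟩
    exact congrArg (Submodule.Quotient.mk (p := I.toSubmodule)) (smul_mul_assoc c a b)

instance [SMulCommClass ℂ A A] (I : AlgIdeal A) : SMulCommClass ℂ I.Quotient I.Quotient where
  smul_comm := by
    rintro c ⟨a⟩ ⟨b⟩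
    exact congrArg (Submodule.Quotient.mk (p := I.toSubmodule)) (mul_smul_comm c a b).symm

/-- The standard quotient map `A → A / I`. -/
def quotientMap (I : AlgIdeal A) : A →ₙₐ[ℂ] I.Quotient where
  toFun := Submodule.Quotient.mk
  map_smul' _ _ := rfl
  map_zero' := rfl
  map_add' _ _ := rfl
  map_mul' _ _ := rfl

/-- The preimage of an ideal under a homomorphism of algebras. -/
def comap {B : Type u} [NonUnitalRing B] [Module ℂ B] (f : A →ₙₐ[ℂ] B) (J : AlgIdeal B) :
    AlgIdeal A where
  carrier := {x | f x ∈ J}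
  add_mem' {x y} hx hy := by
    change f (x + y) ∈ J
    rw [map_add]; exact J.add_mem' hx hy
  zero_mem' := by
    change f 0 ∈ J
    rw [map_zero]; exact J.zero_mem'
  smul_mem' c x hx := by
    change f (c • x) ∈ J
    rw [map_smul]; exact J.smul_mem' c hx
  mul_mem_left a x hx := by
    change f (a * x) ∈ J
    rw [map_mul]; exact J.mul_mem_left (f a) hx
  mul_mem_right a x hx := by
    change f (x * a) ∈ J
    rw [map_mul]; exact J.mul_mem_right (f a) hx

/-- An ideal is commutative if its elements commute with each other. -/
def IsCommutative (J : AlgIdeal A) : Prop := ∀ x ∈ J, ∀ y ∈ J, x * y = y * x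

/-- An ideal `J` is commutative modulo the ideal `I` if `xy - yx ∈ I` for all `x, y ∈ J`. -/
def IsCommutativeMod (J I : AlgIdeal A) : Prop := ∀ x ∈ J, ∀ y ∈ J, x * y - y * x ∈ I

end Algebraic

section Normed

variable {A : Type u} [NonUnitalNormedRing A] [NormedSpace ℂ A]

theorem norm_quotient_mul_le (I : AlgIdeal A) (x y : I.Quotient) :
    ‖x * y‖ ≤ ‖x‖ * ‖y‖ := by
  have key : ∀ δ : ℝ, 0 < δ → ‖x * y‖ ≤ (‖x‖ + δ) * (‖y‖ + δ) := by
    intro δ hδ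
    obtain ⟨a, rfl, ha⟩ := Submodule.Quotient.norm_mk_lt x hδ
    obtain ⟨b, rfl, hb⟩ := Submodule.Quotient.norm_mk_lt y hδ
    have h1 : ‖(Submodule.Quotient.mk (a * b) : I.Quotient)‖ ≤ ‖a * b‖ :=
      Submodule.Quotient.norm_mk_le I.toSubmodule (a * b)
    have h2 : ‖a * b‖ ≤ ‖a‖ * ‖b‖ := norm_mul_le a b
    exact h1.trans (h2.trans (mul_le_mul ha.le hb.le (norm_nonneg _)
      ((norm_nonneg _).trans ha.le)))
  have lim : Filter.Tendsto (fun δ : ℝ => (‖x‖ + δ) * (‖y‖ + δ)) (nhdsWithin 0 (Set.Ioi 0))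
      (nhds (‖x‖ * ‖y‖)) := by
    have hc : Continuous fun δ : ℝ => (‖x‖ + δ) * (‖y‖ + δ) := by fun_prop
    have := (hc.tendsto 0).mono_left (nhdsWithin_le_nhds (s := Set.Ioi 0))
    simpa using this
  exact ge_of_tendsto lim (Filter.eventually_of_mem self_mem_nhdsWithin key)

/-- The quotient of a normed algebra by a closed ideal is a normed algebra with the quotient
norm. -/
noncomputable instance (I : AlgIdeal A) [IsClosed (I.toSubmodule : Set A)] : NonUnitalNormedRing I.Quotient where
  __ := (inferInstance : NonUnitalRing I.Quotient)
  __ := (inferInstance : NormedAddCommGroup I.Quotient)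
  norm_mul_le x y := norm_quotient_mul_le I x y

end Normed

end AlgIdeal

section Normed

/-- A subalgebra of a normed algebra is a normed algebra with the inherited norm. -/
instance {A : Type u} [NonUnitalNormedRing A] [NormedSpace ℂ A] (B : NonUnitalSubalgebra ℂ A) :
    NormedSpace ℂ B where
  norm_smul_le c x := norm_smul_le c (x : A)

/-- The completion of a normed algebra. -/
def CompletionAlg (A : Type u) [NonUnitalNormedRing A] : Type u := UniformSpace.Completion A

namespace CompletionAlg

open UniformSpace UniformSpace.Completion

variable {A : Type u} [NonUnitalNormedRing A]

noncomputable instance : NormedAddCommGroup (CompletionAlg A) :=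
  inferInstanceAs (NormedAddCommGroup (UniformSpace.Completion A))

noncomputable instance [NormedSpace ℂ A] : NormedSpace ℂ (CompletionAlg A) :=
  inferInstanceAs (NormedSpace ℂ (UniformSpace.Completion A))

instance : CompleteSpace (CompletionAlg A) :=
  inferInstanceAs (CompleteSpace (UniformSpace.Completion A))

/-- The canonical embedding of `A` into its completion. -/
def coe (a : A) : CompletionAlg A := ((a : UniformSpace.Completion A) : UniformSpace.Completion A)

theorem denseRange_coe : DenseRange (coe : A → CompletionAlg A) :=
  UniformSpace.Completion.denseRange_coe

theorem isDenseInducing_coe : IsDenseInducing (coe : A → CompletionAlg A) :=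
  UniformSpace.Completion.isDenseInducing_coe

theorem continuous_coe : Continuous (coe : A → CompletionAlg A) :=
  UniformSpace.Completion.continuous_coe A

theorem norm_coe (a : A) : ‖coe a‖ = ‖a‖ := UniformSpace.Completion.norm_coe a

theorem coe_add (a b : A) : coe (a + b) = coe a + coe b := UniformSpace.Completion.coe_add a b

theorem coe_zero : coe (0 : A) = 0 := UniformSpace.Completion.coe_zero

theorem coe_smul [NormedSpace ℂ A] (c : ℂ) (a : A) : coe (c • a) = c • coe a :=
  UniformSpace.Completion.coe_smul c a

/-- The multiplication of the completion: the continuous extension of the multiplication. -/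
noncomputable instance : Mul (CompletionAlg A) where
  mul x y := (isDenseInducing_coe.prodMap isDenseInducing_coe).extend
    (fun p : A × A => (coe (p.1 * p.2) : CompletionAlg A)) (x, y)

theorem coe_mul (a b : A) : coe (a * b) = coe a * coe b :=
  ((isDenseInducing_coe.prodMap isDenseInducing_coe).extend_eq
    (continuous_coe.comp continuous_mul) (a, b)).symm

instance : ContinuousMul (CompletionAlg A) where
  continuous_mul := by
    let i : A →+ CompletionAlg A := ⟨⟨coe, coe_zero⟩, coe_add⟩
    let m := (AddMonoidHom.mul : A →+ A →+ A).compr₂ i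
    have hm : Continuous fun p : A × A => m p.1 p.2 := continuous_coe.comp continuous_mul
    have di : IsDenseInducing (i : A → CompletionAlg A) := isDenseInducing_coe
    exact di.extend_Z_bilin di hm

theorem smul_mul [NormedSpace ℂ A] [IsScalarTower ℂ A A] (c : ℂ) (a b : CompletionAlg A) :
    (c • a) * b = c • (a * b) :=
  denseRange_coe.induction_on₂ (p := fun a b : CompletionAlg A => (c • a) * b = c • (a * b))
    (isClosed_eq ((continuous_fst.const_smul c).mul continuous_snd)
      ((continuous_fst.mul continuous_snd).const_smul c))
    (fun a b => by rw [← coe_smul, ← coe_mul, ← coe_mul, ← coe_smul, smul_mul_assoc]) a b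

theorem mul_smul [NormedSpace ℂ A] [SMulCommClass ℂ A A] (c : ℂ) (a b : CompletionAlg A) :
    a * (c • b) = c • (a * b) :=
  denseRange_coe.induction_on₂ (p := fun a b : CompletionAlg A => a * (c • b) = c • (a * b))
    (isClosed_eq (continuous_fst.mul (continuous_snd.const_smul c))
      ((continuous_fst.mul continuous_snd).const_smul c))
    (fun a b => by rw [← coe_smul, ← coe_mul, ← coe_mul, ← coe_smul, mul_smul_comm]) a b

noncomputable instance : NonUnitalNormedRing (CompletionAlg A) where
  __ := (inferInstance : NormedAddCommGroup (CompletionAlg A))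
  __ := (inferInstance : Mul (CompletionAlg A))
  zero_mul a := denseRange_coe.induction_on a (isClosed_eq (by fun_prop) (by fun_prop))
    fun a => by rw [← coe_zero, ← coe_mul, zero_mul]
  mul_zero a := denseRange_coe.induction_on a (isClosed_eq (by fun_prop) (by fun_prop))
    fun a => by rw [← coe_zero, ← coe_mul, mul_zero]
  mul_assoc a b c := denseRange_coe.induction_on₃ (p := fun a b c => a * b * c = a * (b * c))
    (isClosed_eq (by fun_prop) (by fun_prop))
    (fun a b c => by rw [← coe_mul, ← coe_mul, ← coe_mul, ← coe_mul, mul_assoc]) a b c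
  left_distrib a b c := denseRange_coe.induction_on₃ (p := fun a b c => a * (b + c) = a * b + a * c)
    (isClosed_eq (by fun_prop) (by fun_prop))
    (fun a b c => by rw [← coe_add, ← coe_mul, ← coe_mul, ← coe_mul, ← coe_add, mul_add]) a b c
  right_distrib a b c :=
    denseRange_coe.induction_on₃ (p := fun a b c => (a + b) * c = a * c + b * c)
    (isClosed_eq (by fun_prop) (by fun_prop))
    (fun a b c => by rw [← coe_add, ← coe_mul, ← coe_mul, ← coe_mul, ← coe_add, add_mul]) a b c
  norm_mul_le a b := denseRange_coe.induction_on₂ (p := fun a b => ‖a * b‖ ≤ ‖a‖ * ‖b‖)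
    (isClosed_le (by fun_prop) (by fun_prop))
    (fun a b => by rw [← coe_mul, norm_coe, norm_coe, norm_coe]; exact norm_mul_le a b) a b

variable [NormedSpace ℂ A]

instance [IsScalarTower ℂ A A] : IsScalarTower ℂ (CompletionAlg A) (CompletionAlg A) where
  smul_assoc c a b := smul_mul c a b

instance [SMulCommClass ℂ A A] : SMulCommClass ℂ (CompletionAlg A) (CompletionAlg A) where
  smul_comm c a b := (mul_smul c a b).symm

/-- The canonical embedding of `A` into its completion, as a homomorphism of algebras. -/
def embedding (A : Type u) [NonUnitalNormedRing A] [NormedSpace ℂ A] :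
    A →ₙₐ[ℂ] CompletionAlg A where
  toFun := coe
  map_smul' c a := coe_smul c a
  map_zero' := coe_zero
  map_add' a b := coe_add a b
  map_mul' a b := coe_mul a b

end CompletionAlg

end Normed

/-- The sum of all commutative ideals of an algebra. -/
def sumCommIdeals (A : Type u) [NonUnitalRing A] [Module ℂ A] : AlgIdeal A where
  toSubmodule := ⨆ J : {J : AlgIdeal A // J.IsCommutative}, J.1.toSubmodule
  mul_mem_left a x hx := by
    refine Submodule.iSup_induction (fun J : {J : AlgIdeal A // J.IsCommutative} => J.1.toSubmodule)
      (motive := fun x => a * x ∈ ⨆ J : {J : AlgIdeal A // J.IsCommutative}, J.1.toSubmodule)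
      hx (fun J y hy => ?_) ?_ fun y z hy hz => ?_
    · exact Submodule.mem_iSup_of_mem J (J.1.mul_mem_left a hy)
    · rw [mul_zero]; exact Submodule.zero_mem _
    · rw [mul_add]; exact Submodule.add_mem _ hy hz
  mul_mem_right a x hx := by
    refine Submodule.iSup_induction (fun J : {J : AlgIdeal A // J.IsCommutative} => J.1.toSubmodule)
      (motive := fun x => x * a ∈ ⨆ J : {J : AlgIdeal A // J.IsCommutative}, J.1.toSubmodule)
      hx (fun J y hy => ?_) ?_ fun y z hy hz => ?_
    · exact Submodule.mem_iSup_of_mem J (J.1.mul_mem_right a hy)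
    · rw [zero_mul]; exact Submodule.zero_mem _
    · rw [add_mul]; exact Submodule.add_mem _ hy hz

/-- A (not necessarily closed) ideal map on the class of all normed complex associative algebras. -/
def IdealMap : Type (u + 1) :=
  ∀ (A : Type u) [NonUnitalNormedRing A] [NormedSpace ℂ A] [IsScalarTower ℂ A A]
    [SMulCommClass ℂ A A], AlgIdeal A

namespace IdealMap

/-- A topological radical on the class of all normed algebras. -/
structure IsTopologicalRadical (P : IdealMap.{u}) : Prop where
  isClosed : ∀ (A : Type u) [NonUnitalNormedRing A] [NormedSpace ℂ A] [IsScalarTower ℂ A A]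
    [SMulCommClass ℂ A A], IsClosed ((P A).toSubmodule : Set A)
  /-- `f (P A) ⊆ P B` for every open continuous surjective homomorphism `f : A → B`. -/
  map_le : ∀ (A B : Type u) [NonUnitalNormedRing A] [NormedSpace ℂ A] [IsScalarTower ℂ A A]
    [SMulCommClass ℂ A A] [NonUnitalNormedRing B] [NormedSpace ℂ B] [IsScalarTower ℂ B B]
    [SMulCommClass ℂ B B] (f : A →ₙₐ[ℂ] B), Continuous f → IsOpenMap f → Function.Surjective f →
    ∀ x ∈ P A, f x ∈ P B
  /-- `P (A / P A) = 0`. -/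
  quotient : ∀ (A : Type u) [NonUnitalNormedRing A] [NormedSpace ℂ A] [IsScalarTower ℂ A A]
    [SMulCommClass ℂ A A] [IsClosed ((P A).toSubmodule : Set A)], P (P A).Quotient = ⊥
  /-- `P (P A) = P A`. -/
  idem : ∀ (A : Type u) [NonUnitalNormedRing A] [NormedSpace ℂ A] [IsScalarTower ℂ A A]
    [SMulCommClass ℂ A A], P (P A).toSubalgebra = ⊤
  /-- `P I` is an ideal of `A` contained in `P A`, for every (not necessarily closed) ideal `I`. -/
  ideal : ∀ (A : Type u) [NonUnitalNormedRing A] [NormedSpace ℂ A] [IsScalarTower ℂ A A]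
    [SMulCommClass ℂ A A] (I : AlgIdeal A), ∃ K : AlgIdeal A,
    (K : Set A) = Subtype.val '' (P I.toSubalgebra : Set I.toSubalgebra) ∧ K ≤ P A

/-- `P` is hereditary if `P I = I ∩ P A` for every ideal `I` of a normed algebra `A`. -/
def IsHereditary (P : IdealMap.{u}) : Prop :=
  ∀ (A : Type u) [NonUnitalNormedRing A] [NormedSpace ℂ A] [IsScalarTower ℂ A A]
    [SMulCommClass ℂ A A] (I : AlgIdeal A) (x : I.toSubalgebra), x ∈ P I.toSubalgebra ↔ (x : A) ∈ P A

/-- `P` is uniform if every subalgebra `B` of a normed algebra `A` with `P A = A` satisfies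
`P B = B`. -/
def IsUniform (P : IdealMap.{u}) : Prop :=
  ∀ (A : Type u) [NonUnitalNormedRing A] [NormedSpace ℂ A] [IsScalarTower ℂ A A]
    [SMulCommClass ℂ A A] (B : NonUnitalSubalgebra ℂ A), P A = ⊤ → P B = ⊤

/-- The regularization `Pʳ` of `P`: `Pʳ A = A ∩ P Â`, where `Â` is the completion of `A`. -/
noncomputable def regularization (P : IdealMap.{u}) : IdealMap.{u} :=
  fun A _ _ _ _ => (P (CompletionAlg A)).comap (CompletionAlg.embedding A)

/-- A regular radical: a hereditary topological radical that is equal to its regularization. -/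
structure IsRegular (P : IdealMap.{u}) : Prop where
  isTopologicalRadical : P.IsTopologicalRadical
  isHereditary : P.IsHereditary
  eq_regularization : P = P.regularization

/-- The centralization `Pᵃ` of `P`: `Pᵃ A` is the preimage, under the quotient map `A → A / P A`,
of the sum of all commutative ideals of `A / P A`. -/
def centralization (P : IdealMap.{u}) : IdealMap.{u} :=
  fun A _ _ _ _ => (sumCommIdeals (P A).Quotient).comap (P A).quotientMap

end IdealMap

section TensorRadius

section Families

variable {A : Type u} [NonUnitalNormedRing A]

/-- `‖M‖₊ = ∑ ‖aᵢ‖` for a family `M = (aᵢ)`. -/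
noncomputable def familyNorm {ι : Type} (M : ι → A) : ℝ≥0∞ := ∑' i, ‖M i‖ₑ

/-- A family is summable if `‖M‖₊ < ∞`. -/
def IsSummableFamily {ι : Type} (M : ι → A) : Prop := familyNorm M < ∞

/-- The product of the families `(aᵢ)` and `(bⱼ)` is the family of all `aᵢ bⱼ`. -/
def familyMul {ι κ : Type} (M : ι → A) (N : κ → A) : ι × κ → A := fun p => M p.1 * N p.2

/-- The index set of the family `M ^ (n + 1)`, for a family `M` indexed by `ι`. -/
def PowIndex (ι : Type) : ℕ → Type
  | 0 => ι
  | n + 1 => ι × PowIndex ι n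

/-- `familyPow M n` is the power `M ^ (n + 1)`: `M ^ 1 = M` and `M ^ (n + 2) = M * M ^ (n + 1)`. -/
def familyPow {ι : Type} (M : ι → A) : ∀ n : ℕ, PowIndex ι n → A
  | 0 => M
  | n + 1 => familyMul M (familyPow M n)

/-- The tensor spectral radius: the infimum of `‖M ^ n‖₊ ^ (1 / n)` over `n ≥ 1`. -/
noncomputable def tensorRadius {ι : Type} (M : ι → A) : ℝ≥0∞ :=
  ⨅ n : ℕ, familyNorm (familyPow M n) ^ (1 / ((n : ℝ) + 1))

/-- The disjoint union `{a} ⊔ M` of the one-element family `{a}` and a family `M`. -/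
def adjoin {ι : Type} (a : A) (M : ι → A) : Unit ⊕ ι → A := Sum.elim (fun _ => a) M

/-- Summing over words: `wordSum M n x` is the sum of the norms `‖x w‖` over all words `w` of
length `n` in the family `M`. -/
noncomputable def wordSum {ι : Type} (M : ι → A) : ℕ → A → ℝ≥0∞
  | 0, x => ‖x‖ₑ
  | n + 1, x => ∑' i, wordSum M n (x * M i)

theorem enorm_mul_le_mul (x y : A) : ‖x * y‖ₑ ≤ ‖x‖ₑ * ‖y‖ₑ := by
  simp only [← ofReal_norm]
  rw [← ENNReal.ofReal_mul (norm_nonneg x)]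
  exact ENNReal.ofReal_le_ofReal (norm_mul_le x y)

theorem tsum_adjoin {ι : Type} (a : A) (M : ι → A) (F : A → ℝ≥0∞) :
    ∑' s, F (adjoin a M s) = F a + ∑' i, F (M i) := by
  rw [ENNReal.summable.tsum_sum ENNReal.summable, tsum_fintype]
  simp [adjoin]

variable {ι : Type} (M : ι → A)

theorem wordSum_succ_eq (n : ℕ) : ∀ x : A,
    ∑' p, ‖x * familyPow M n p‖ₑ = wordSum M (n + 1) x := by
  induction n with
  | zero => intro x; rfl
  | succ n ih =>
    intro x
    change ∑' p : ι × PowIndex ι n, ‖x * (M p.1 * familyPow M n p.2)‖ₑ = _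
    rw [ENNReal.tsum_prod']
    change _ = ∑' i, wordSum M (n + 1) (x * M i)
    refine tsum_congr fun i => ?_
    rw [← ih]
    refine tsum_congr fun p => ?_
    rw [mul_assoc]

theorem familyNorm_pow (n : ℕ) : familyNorm (familyPow M n) = ∑' i, wordSum M n (M i) := by
  cases n with
  | zero => rfl
  | succ n =>
    change ∑' p : ι × PowIndex ι n, ‖M p.1 * familyPow M n p.2‖ₑ = _
    rw [ENNReal.tsum_prod']
    exact tsum_congr fun i => wordSum_succ_eq M n (M i)

theorem wordSum_reindex {κ : Type} (e : κ ≃ ι) (n : ℕ) :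
    ∀ x, wordSum (M ∘ e) n x = wordSum M n x := by
  induction n with
  | zero => intro x; rfl
  | succ n ih =>
    intro x
    change ∑' k, wordSum (M ∘ e) n (x * M (e k)) = _
    simp_rw [ih]
    exact e.tsum_eq fun i => wordSum M n (x * M i)

theorem tensorRadius_reindex {κ : Type} (e : κ ≃ ι) : tensorRadius (M ∘ e) = tensorRadius M := by
  unfold tensorRadius
  simp_rw [familyNorm_pow, wordSum_reindex]
  refine iInf_congr fun n => ?_
  congr 1
  exact e.tsum_eq fun i => wordSum M n (M i)

theorem wordSum_adjoin (a : A) (n : ℕ) (x : A) : wordSum (adjoin a M) (n + 1) x =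
    wordSum (adjoin a M) n (x * a) + ∑' i, wordSum (adjoin a M) n (x * M i) := by
  exact tsum_adjoin a M fun y => wordSum (adjoin a M) n (x * y)

theorem familyNorm_pow_adjoin (a : A) (n : ℕ) : familyNorm (familyPow (adjoin a M) n) =
    wordSum (adjoin a M) n a + ∑' i, wordSum (adjoin a M) n (M i) := by
  rw [familyNorm_pow]
  exact tsum_adjoin a M fun y => wordSum (adjoin a M) n y

theorem familyNorm_adjoin (a : A) : familyNorm (adjoin a M) = ‖a‖ₑ + familyNorm M :=
  familyNorm_pow_adjoin M a 0

theorem isSummableFamily_adjoin (a : A) (h : IsSummableFamily M) :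
    IsSummableFamily (adjoin a M) := by
  unfold IsSummableFamily
  rw [familyNorm_adjoin]
  exact ENNReal.add_lt_top.2 ⟨enorm_lt_top, h⟩

theorem wordSum_le_adjoin (a : A) (n : ℕ) : ∀ x, wordSum M n x ≤ wordSum (adjoin a M) n x := by
  induction n with
  | zero => intro x; exact le_rfl
  | succ n ih =>
    intro x
    rw [wordSum_adjoin]
    exact le_add_left (ENNReal.tsum_le_tsum fun i => ih _)

theorem tensorRadius_le_adjoin (a : A) : tensorRadius M ≤ tensorRadius (adjoin a M) := by
  refine iInf_mono fun n => ENNReal.rpow_le_rpow ?_ (by positivity)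
  rw [familyNorm_pow, familyNorm_pow_adjoin]
  exact le_add_left (ENNReal.tsum_le_tsum fun i => wordSum_le_adjoin M a n _)

theorem wordSum_succ_le (n : ℕ) (x : A) :
    wordSum M (n + 1) x ≤ familyNorm (familyPow M n) * ‖x‖ₑ := by
  rw [← wordSum_succ_eq, mul_comm, familyNorm, ← ENNReal.tsum_mul_left]
  exact ENNReal.tsum_le_tsum fun p => enorm_mul_le_mul _ _

theorem wordSum_add_le (m n : ℕ) : ∀ x,
    wordSum M (m + (n + 1)) x ≤ familyNorm (familyPow M n) * wordSum M m x := by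
  induction m with
  | zero => intro x; rw [zero_add]; exact wordSum_succ_le M n x
  | succ m ih =>
    intro x
    rw [show m + 1 + (n + 1) = (m + (n + 1)) + 1 by ring]
    change ∑' i, wordSum M (m + (n + 1)) (x * M i) ≤ _ * ∑' i, wordSum M m (x * M i)
    rw [← ENNReal.tsum_mul_left]
    exact ENNReal.tsum_le_tsum fun i => ih _

theorem familyNorm_pow_add_le (m n : ℕ) : familyNorm (familyPow M (m + (n + 1))) ≤
    familyNorm (familyPow M n) * familyNorm (familyPow M m) := by
  rw [familyNorm_pow M (m + (n + 1)), familyNorm_pow M m, ← ENNReal.tsum_mul_left]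
  exact ENNReal.tsum_le_tsum fun i => wordSum_add_le M m n _

theorem familyNorm_pow_lt_top (h : IsSummableFamily M) (n : ℕ) :
    familyNorm (familyPow M n) < ∞ := by
  induction n with
  | zero => exact h
  | succ n ih => exact (familyNorm_pow_add_le M n 0).trans_lt (ENNReal.mul_lt_top h ih)

/-- The sum of the norms of all nonempty words. -/
noncomputable def totalSum : ℝ≥0∞ := ∑' n, familyNorm (familyPow M n)

theorem totalSum_lt_top (h : IsSummableFamily M) (hr : tensorRadius M < 1) : totalSum M < ∞ := by
  obtain ⟨n, hn⟩ := iInf_lt_iff.1 hr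
  have hq : familyNorm (familyPow M n) < 1 := by
    by_contra hc
    exact absurd hn (not_lt.2 (ENNReal.one_le_rpow (not_lt.1 hc) (by positivity)))
  set s : ℕ → ℝ≥0∞ := fun k => familyNorm (familyPow M k) with hs
  have hfin : ∀ K, ∑ k ∈ Finset.range K, s k < ∞ := fun K =>
    ENNReal.sum_lt_top.2 fun k _ => familyNorm_pow_lt_top M h k
  set C := ∑ k ∈ Finset.range (n + 1), s k with hC
  have step : ∀ K, ∑ k ∈ Finset.range K, s k ≤ C + s n * ∑ k ∈ Finset.range K, s k := by
    intro K
    calc ∑ k ∈ Finset.range K, s k ≤ ∑ k ∈ Finset.range (n + 1 + K), s k :=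
          Finset.sum_le_sum_of_subset (Finset.range_mono (by omega))
      _ = C + ∑ k ∈ Finset.range K, s (n + 1 + k) := by rw [Finset.sum_range_add]
      _ ≤ _ := by
          gcongr
          rw [Finset.mul_sum]
          refine Finset.sum_le_sum fun k _ => ?_
          rw [add_comm (n + 1) k]
          exact familyNorm_pow_add_le M k n
  have bound : ∀ K, ∑ k ∈ Finset.range K, s k ≤ C / (1 - s n) := by
    intro K
    rw [ENNReal.le_div_iff_mul_le (Or.inl (tsub_pos_of_lt hq).ne')
      (Or.inl (ENNReal.sub_ne_top ENNReal.one_ne_top)),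
      ENNReal.mul_sub (fun _ _ => (hfin K).ne), mul_one, tsub_le_iff_right, mul_comm]
    exact step K
  refine lt_of_le_of_lt (ENNReal.tsum_le_of_sum_range_le bound) ?_
  exact ENNReal.div_lt_top (hfin _).ne (tsub_pos_of_lt hq).ne'

theorem tensorRadius_le_one (h : totalSum M < ∞) : tensorRadius M ≤ 1 := by
  have := ENNReal.tendsto_atTop_zero_of_tsum_ne_top h.ne
  obtain ⟨n, hn⟩ := (this.eventually_le_const (zero_lt_one : (0 : ℝ≥0∞) < 1)).exists
  exact (iInf_le _ n).trans (ENNReal.rpow_le_one hn (by positivity))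

theorem wordSum_add_le_add (n : ℕ) : ∀ x y,
    wordSum M n (x + y) ≤ wordSum M n x + wordSum M n y := by
  induction n with
  | zero => intro x y; exact enorm_add_le _ _
  | succ n ih =>
    intro x y
    change ∑' i, wordSum M n ((x + y) * M i) ≤
      (∑' i, wordSum M n (x * M i)) + ∑' i, wordSum M n (y * M i)
    rw [← ENNReal.tsum_add]
    refine ENNReal.tsum_le_tsum fun i => ?_
    rw [add_mul]
    exact ih _ _

theorem wordSum_adjoin_add (a b : A) (n : ℕ) : ∀ x, wordSum (adjoin (a + b) M) n x ≤
    wordSum (adjoin a (adjoin b M)) n x := by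
  induction n with
  | zero => intro x; exact le_rfl
  | succ n ih =>
    intro x
    rw [wordSum_adjoin, wordSum_adjoin]
    rw [tsum_adjoin b M fun y => wordSum (adjoin a (adjoin b M)) n (x * y), ← add_assoc]
    refine add_le_add ?_ (ENNReal.tsum_le_tsum fun i => ih _)
    rw [mul_add]
    exact (ih _).trans (wordSum_add_le_add _ _ _ _)

theorem tensorRadius_adjoin_add_le (a b : A) :
    tensorRadius (adjoin (a + b) M) ≤ tensorRadius (adjoin a (adjoin b M)) := by
  refine iInf_mono fun n => ENNReal.rpow_le_rpow ?_ (by positivity)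
  rw [familyNorm_pow_adjoin, familyNorm_pow_adjoin,
    tsum_adjoin b M fun y => wordSum (adjoin a (adjoin b M)) n y, ← add_assoc]
  refine add_le_add ?_ (ENNReal.tsum_le_tsum fun i => wordSum_adjoin_add M a b n _)
  exact (wordSum_adjoin_add M a b n _).trans (wordSum_add_le_add _ _ _ _)

/-- Sum of the norms `‖x w‖` over all words `w`, the empty one included. -/
noncomputable def allWords (x : A) : ℝ≥0∞ := ∑' n, wordSum M n x

theorem totalSum_eq : totalSum M = ∑' i, allWords M (M i) := by
  unfold totalSum allWords
  simp_rw [familyNorm_pow]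
  exact ENNReal.tsum_comm

theorem allWords_eq (x : A) : allWords M x = ‖x‖ₑ + ∑' i, allWords M (x * M i) := by
  unfold allWords
  rw [tsum_eq_zero_add' ENNReal.summable, ENNReal.tsum_comm]
  rfl

theorem allWords_mul_le (x : A) (i : ι) : allWords M (x * M i) ≤ allWords M x := by
  rw [allWords_eq M x]
  exact le_add_left (ENNReal.le_tsum i)

theorem allWords_adjoin_le {κ : Type} (N : κ → A) (c : A) (f : ι → κ) (hf : f.Injective)
    (hM : ∀ i, N (f i) = M i) (i j : κ) (hi : i ∉ Set.range f) (hc : c = N i * N j) (x : A) :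
    allWords (adjoin c M) x ≤ allWords N x := by
  have split : ∀ g : κ → ℝ≥0∞, g i + ∑' k, g (f k) ≤ ∑' k, g k := by
    intro g
    have hinj : Function.Injective (Sum.elim (fun _ : Unit => i) f) := by
      rintro (_ | k) (_ | l) h
      · rfl
      · exact absurd ⟨l, h.symm⟩ hi
      · exact absurd ⟨k, h⟩ hi
      · exact congrArg Sum.inr (hf h)
    have := ENNReal.tsum_comp_le_tsum_of_injective hinj g
    rwa [ENNReal.summable.tsum_sum ENNReal.summable, tsum_fintype, Fintype.sum_unique] at this
  have key : ∀ K x, ∑ n ∈ Finset.range K, wordSum (adjoin c M) n x ≤ allWords N x := by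
    intro K
    induction K with
    | zero => intro x; simp
    | succ K ih =>
      intro x
      rw [Finset.sum_range_succ', allWords_eq N x, add_comm]
      refine add_le_add le_rfl ?_
      simp_rw [wordSum_adjoin]
      rw [Finset.sum_add_distrib]
      refine le_trans ?_ (split fun k => allWords N (x * N k))
      refine add_le_add ?_ ?_
      · refine (ih _).trans ?_
        rw [hc, ← mul_assoc]
        exact allWords_mul_le N _ j
      · rw [← Summable.tsum_finsetSum fun _ _ => ENNReal.summable]
        refine ENNReal.tsum_le_tsum fun k => ?_
        simp only [hM]
        exact ih _
  exact ENNReal.tsum_le_of_sum_range_le fun K => key K x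

theorem totalSum_adjoin_le {κ : Type} (N : κ → A) (c : A) (f : ι → κ) (hf : f.Injective)
    (hM : ∀ i, N (f i) = M i) (i j : κ) (hi : i ∉ Set.range f) (hc : c = N i * N j) :
    totalSum (adjoin c M) ≤ allWords N c + totalSum N := by
  rw [totalSum_eq, totalSum_eq, tsum_adjoin c M fun y => allWords (adjoin c M) y]
  refine add_le_add (allWords_adjoin_le M N c f hf hM i j hi hc _) ?_
  refine le_trans (ENNReal.tsum_le_tsum fun k => ?_)
    (ENNReal.tsum_comp_le_tsum_of_injective hf fun k => allWords N (N k))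
  simp only [hM]
  exact allWords_adjoin_le M N c f hf hM i j hi hc _

theorem tensorRadius_adjoin_mul_le {κ : Type} (N : κ → A) (c : A) (f : ι → κ) (hf : f.Injective)
    (hM : ∀ i, N (f i) = M i) (i j : κ) (hi : i ∉ Set.range f) (hc : c = N i * N j)
    (hN : totalSum N < ∞) : tensorRadius (adjoin c M) ≤ 1 := by
  refine tensorRadius_le_one _ ((totalSum_adjoin_le M N c f hf hM i j hi hc).trans_lt ?_)
  refine ENNReal.add_lt_top.2 ⟨lt_of_le_of_lt ?_ hN, hN⟩
  rw [hc, totalSum_eq]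
  exact (allWords_mul_le N _ j).trans (ENNReal.le_tsum i)

end Families

section Homogeneity

variable {A : Type u} [NonUnitalNormedRing A] [NormedSpace ℂ A] [IsScalarTower ℂ A A]
  [SMulCommClass ℂ A A] {ι : Type} (M : ι → A)

theorem wordSum_const_smul (c : ℂ) (n : ℕ) :
    ∀ x, wordSum M n (c • x) = ‖c‖ₑ * wordSum M n x := by
  induction n with
  | zero => intro x; exact enorm_smul c x
  | succ n ih =>
    intro x
    change ∑' i, wordSum M n ((c • x) * M i) = _ * ∑' i, wordSum M n (x * M i)
    simp_rw [smul_mul_assoc, ih]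
    exact ENNReal.tsum_mul_left

theorem wordSum_smul (c : ℂ) (n : ℕ) :
    ∀ x, wordSum (c • M) n x = ‖c‖ₑ ^ n * wordSum M n x := by
  induction n with
  | zero => intro x; simp [wordSum]
  | succ n ih =>
    intro x
    change ∑' i, wordSum (c • M) n (x * (c • M i)) = _ * ∑' i, wordSum M n (x * M i)
    simp_rw [ih, mul_smul_comm, wordSum_const_smul]
    rw [← ENNReal.tsum_mul_left]
    refine tsum_congr fun i => ?_
    ring

theorem familyNorm_pow_smul (c : ℂ) (n : ℕ) :
    familyNorm (familyPow (c • M) n) = ‖c‖ₑ ^ (n + 1) * familyNorm (familyPow M n) := by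
  rw [familyNorm_pow, familyNorm_pow, ← ENNReal.tsum_mul_left]
  refine tsum_congr fun i => ?_
  rw [wordSum_smul, Pi.smul_apply, wordSum_const_smul]
  ring

theorem isSummableFamily_smul (c : ℂ) (h : IsSummableFamily M) : IsSummableFamily (c • M) := by
  have := familyNorm_pow_smul M c 0
  unfold IsSummableFamily at *
  change familyNorm (c • M) = _ * familyNorm M at this
  rw [this]
  exact ENNReal.mul_lt_top (by simp [enorm_lt_top]) h

theorem tensorRadius_smul {c : ℂ} (hc : c ≠ 0) :
    tensorRadius (c • M) = ‖c‖ₑ * tensorRadius M := by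
  have h0 : ‖c‖ₑ ≠ 0 := by simpa using hc
  unfold tensorRadius
  rw [ENNReal.mul_iInf_of_ne h0 enorm_ne_top]
  refine iInf_congr fun n => ?_
  rw [familyNorm_pow_smul, ENNReal.mul_rpow_of_nonneg _ _ (by positivity), ← ENNReal.rpow_natCast,
    ← ENNReal.rpow_mul]
  congr 1
  have : ((n + 1 : ℕ) : ℝ) * (1 / ((n : ℝ) + 1)) = 1 := by
    push_cast
    field_simp
  rw [this, ENNReal.rpow_one]

theorem adjoin_smul (c : ℂ) (a : A) : adjoin (c • a) (c • M) = c • adjoin a M := by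
  funext s
  rcases s with _ | i <;> rfl

/-- Adjoining a small multiple of an element keeps the tensor radius below one. -/
theorem exists_adjoin_lt_one (b : A) (h : IsSummableFamily M) (hr : tensorRadius M < 1) :
    ∃ ε : ℝ, 0 < ε ∧ tensorRadius (adjoin ((ε : ℂ) • b) M) < 1 := by
  obtain ⟨n, hn⟩ := iInf_lt_iff.1 hr
  have est : ∀ k : ℕ, ∃ C : ℝ≥0∞, C < ∞ ∧ ∀ ε : ℝ, 0 < ε → ε ≤ 1 → ∀ x,
      wordSum (adjoin ((ε : ℂ) • b) M) k x ≤ wordSum M k x + ENNReal.ofReal ε * (C * ‖x‖ₑ) := by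
    intro k
    induction k with
    | zero => exact ⟨0, by simp, fun ε _ _ x => by simp [wordSum]⟩
    | succ k ih =>
      obtain ⟨C, hC, hCx⟩ := ih
      obtain ⟨D, hD, hDx⟩ : ∃ D : ℝ≥0∞, D < ∞ ∧ ∀ x, wordSum M k x ≤ D * ‖x‖ₑ := by
        cases k with
        | zero => exact ⟨1, by simp, fun x => by simp [wordSum]⟩
        | succ k => exact ⟨_, familyNorm_pow_lt_top M h k, wordSum_succ_le M k⟩
      refine ⟨(D + C) * ‖b‖ₑ + C * familyNorm M, ?_, fun ε h0 h1 x => ?_⟩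
      · exact ENNReal.add_lt_top.2 ⟨ENNReal.mul_lt_top (ENNReal.add_lt_top.2 ⟨hD, hC⟩) enorm_lt_top,
          ENNReal.mul_lt_top hC h⟩
      · have hε : ‖(ε : ℂ)‖ₑ = ENNReal.ofReal ε := by
          rw [← ofReal_norm, Complex.norm_real, Real.norm_of_nonneg h0.le]
        have hε1 : ENNReal.ofReal ε ≤ 1 := ENNReal.ofReal_le_one.2 h1
        rw [wordSum_adjoin]
        have e1 : wordSum (adjoin ((ε : ℂ) • b) M) k (x * ((ε : ℂ) • b)) ≤
            ENNReal.ofReal ε * ((D + C) * ‖b‖ₑ * ‖x‖ₑ) := by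
          rw [mul_smul_comm, wordSum_const_smul, hε]
          gcongr
          calc _ ≤ D * ‖x * b‖ₑ + 1 * (C * ‖x * b‖ₑ) :=
                (hCx ε h0 h1 _).trans (by gcongr; exact hDx _)
            _ = (D + C) * ‖x * b‖ₑ := by ring
            _ ≤ (D + C) * (‖x‖ₑ * ‖b‖ₑ) := by gcongr; exact enorm_mul_le_mul _ _
            _ = _ := by ring
        have e2 : ∑' i, wordSum (adjoin ((ε : ℂ) • b) M) k (x * M i) ≤
            wordSum M (k + 1) x + ENNReal.ofReal ε * (C * familyNorm M * ‖x‖ₑ) := by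
          calc _ ≤ ∑' i, (wordSum M k (x * M i) +
                    ENNReal.ofReal ε * (C * ‖x‖ₑ) * ‖M i‖ₑ) := by
                refine ENNReal.tsum_le_tsum fun i => (hCx ε h0 h1 _).trans ?_
                refine add_le_add le_rfl ?_
                calc ENNReal.ofReal ε * (C * ‖x * M i‖ₑ)
                    ≤ ENNReal.ofReal ε * (C * (‖x‖ₑ * ‖M i‖ₑ)) := by
                      gcongr; exact enorm_mul_le_mul _ _
                  _ = _ := by ring
            _ = _ := by
                rw [ENNReal.tsum_add, ENNReal.tsum_mul_left]
                change wordSum M (k + 1) x + _ * familyNorm M = _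
                ring
        calc _ ≤ _ := add_le_add e1 e2
          _ = _ := by ring
  have hq : familyNorm (familyPow M n) < 1 := by
    by_contra hc
    exact absurd hn (not_lt.2 (ENNReal.one_le_rpow (not_lt.1 hc) (by positivity)))
  obtain ⟨C, hC, hCx⟩ := est (n + 1)
  obtain ⟨C', hC', hCx'⟩ := est n
  obtain ⟨D, hD, hDx⟩ : ∃ D : ℝ≥0∞, D < ∞ ∧ ∀ x, wordSum M n x ≤ D * ‖x‖ₑ := by
    cases n with
    | zero => exact ⟨1, by simp, fun x => by simp [wordSum]⟩
    | succ k => exact ⟨_, familyNorm_pow_lt_top M h k, wordSum_succ_le M k⟩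
  have fin : ∀ ε : ℝ, 0 < ε → ε ≤ 1 → familyNorm (familyPow (adjoin ((ε : ℂ) • b) M) n) ≤
      familyNorm (familyPow M n) +
        ENNReal.ofReal ε * ((D + C') * ‖b‖ₑ + C' * familyNorm M) := by
    intro ε h0 h1
    have hε : ‖(ε : ℂ)‖ₑ = ENNReal.ofReal ε := by
      rw [← ofReal_norm, Complex.norm_real, Real.norm_of_nonneg h0.le]
    have hε1 : ENNReal.ofReal ε ≤ 1 := ENNReal.ofReal_le_one.2 h1
    rw [familyNorm_pow_adjoin, familyNorm_pow M n]
    have e1 : wordSum (adjoin ((ε : ℂ) • b) M) n ((ε : ℂ) • b) ≤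
        ENNReal.ofReal ε * ((D + C') * ‖b‖ₑ) := by
      rw [wordSum_const_smul, hε]
      gcongr
      calc _ ≤ D * ‖b‖ₑ + 1 * (C' * ‖b‖ₑ) :=
            (hCx' ε h0 h1 _).trans (by gcongr; exact hDx _)
        _ = _ := by ring
    have e2 : ∑' i, wordSum (adjoin ((ε : ℂ) • b) M) n (M i) ≤
        ∑' i, wordSum M n (M i) + ENNReal.ofReal ε * (C' * familyNorm M) := by
      calc _ ≤ ∑' i, (wordSum M n (M i) + ENNReal.ofReal ε * C' * ‖M i‖ₑ) := by
            refine ENNReal.tsum_le_tsum fun i => (hCx' ε h0 h1 _).trans ?_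
            rw [mul_assoc]
        _ = _ := by
            rw [ENNReal.tsum_add, ENNReal.tsum_mul_left, mul_assoc]
            rfl
    calc _ ≤ _ := add_le_add e1 e2
      _ = _ := by ring
  set E := (D + C') * ‖b‖ₑ + C' * familyNorm M with hE
  have hEfin : E ≠ ∞ := (ENNReal.add_lt_top.2 ⟨ENNReal.mul_lt_top (ENNReal.add_lt_top.2 ⟨hD, hC'⟩)
    enorm_lt_top, ENNReal.mul_lt_top hC' h⟩).ne
  have lim : Filter.Tendsto (fun ε : ℝ => familyNorm (familyPow M n) + ENNReal.ofReal ε * E)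
      (nhdsWithin 0 (Set.Ioi 0)) (nhds (familyNorm (familyPow M n))) := by
    have h1 : Filter.Tendsto (fun ε : ℝ => ENNReal.ofReal ε) (nhdsWithin 0 (Set.Ioi 0))
        (nhds 0) := by
      have := (ENNReal.continuous_ofReal.tendsto 0).mono_left
        (nhdsWithin_le_nhds (s := Set.Ioi (0 : ℝ)))
      simpa using this
    have h2 := ENNReal.Tendsto.mul_const h1 (Or.inr hEfin)
    simpa using h2.const_add (familyNorm (familyPow M n))
  have ev := (lim.eventually_lt_const hq).and
    (Ioc_mem_nhdsGT (zero_lt_one : (0 : ℝ) < 1))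
  obtain ⟨ε, hlt, h0, h1⟩ := ev.exists
  refine ⟨ε, h0, (iInf_le _ n).trans_lt ?_⟩
  exact ENNReal.rpow_lt_one ((fin ε h0 h1).trans_lt hlt) (by positivity)

/-- The elements of the tensor Jacobson radical: all `a` such that the tensor radius of
`{a} ⊔ M` is that of `M`, for every summable family `M = (a₁, a₂, …)`. -/
def IsTensorRadicalElement (a : A) : Prop :=
  ∀ M : ℕ → A, IsSummableFamily M → tensorRadius (adjoin a M) = tensorRadius M

variable {M} {a b : A}

theorem IsTensorRadicalElement.eq (ha : IsTensorRadicalElement a) (e : ℕ ≃ ι)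
    (h : IsSummableFamily M) : tensorRadius (adjoin a M) = tensorRadius M := by
  have hM : IsSummableFamily (M ∘ e) := by
    unfold IsSummableFamily familyNorm
    change ∑' k, ‖M (e k)‖ₑ < ∞
    rw [e.tsum_eq fun i => ‖M i‖ₑ]
    exact h
  have h1 := ha (M ∘ e) hM
  rw [tensorRadius_reindex] at h1
  rw [← h1, ← tensorRadius_reindex (adjoin a M) ((Equiv.refl Unit).sumCongr e)]
  congr 1
  funext s
  rcases s with _ | i <;> rfl

theorem IsTensorRadicalElement.smul (ha : IsTensorRadicalElement a) {c : ℂ} (hc : c ≠ 0) :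
    IsTensorRadicalElement (c • a) := by
  intro M hM
  have h : c • c⁻¹ • M = M := smul_inv_smul₀ hc M
  have h1 := ha (c⁻¹ • M) (isSummableFamily_smul M _ hM)
  calc tensorRadius (adjoin (c • a) M) = tensorRadius (adjoin (c • a) (c • c⁻¹ • M)) := by rw [h]
    _ = ‖c‖ₑ * tensorRadius (adjoin a (c⁻¹ • M)) := by rw [adjoin_smul, tensorRadius_smul _ hc]
    _ = tensorRadius (c • c⁻¹ • M) := by rw [h1, ← tensorRadius_smul _ hc]
    _ = tensorRadius M := by rw [h]

theorem isTensorRadicalElement_of (h : ∀ c : ℂ, c ≠ 0 → ∀ M : ℕ → A, IsSummableFamily M →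
    tensorRadius M < 1 → tensorRadius (adjoin (c • a) M) ≤ 1) : IsTensorRadicalElement a := by
  intro M hM
  refine le_antisymm (le_of_forall_gt fun r hr => ?_) (tensorRadius_le_adjoin M a)
  obtain ⟨q, hq, hqr⟩ := ENNReal.lt_iff_exists_nnreal_btwn.1 hr
  refine lt_of_le_of_lt ?_ hqr
  have hq0 : q ≠ 0 := by
    rintro rfl
    simp at hq
  have hc : (((q : ℝ)⁻¹ : ℝ) : ℂ) ≠ 0 := by simpa using hq0
  have hn : ‖(((q : ℝ)⁻¹ : ℝ) : ℂ)‖ₑ = (q : ℝ≥0∞)⁻¹ := by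
    rw [← ofReal_norm, Complex.norm_real, Real.norm_of_nonneg (by positivity),
      ENNReal.ofReal_inv_of_pos (by positivity), ENNReal.ofReal_coe_nnreal]
  have h1 : tensorRadius ((((q : ℝ)⁻¹ : ℝ) : ℂ) • M) < 1 := by
    rw [tensorRadius_smul M hc, hn, mul_comm, ← div_eq_mul_inv]
    exact ENNReal.div_lt_of_lt_mul (by simpa using hq)
  have h2 := h _ hc _ (isSummableFamily_smul M _ hM) h1
  rw [adjoin_smul, tensorRadius_smul _ hc, hn, mul_comm, ← div_eq_mul_inv] at h2
  simpa using (ENNReal.div_le_iff (by simpa using hq0) ENNReal.coe_ne_top).1 h2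

theorem isTensorRadicalElement_zero : IsTensorRadicalElement (0 : A) := by
  refine isTensorRadicalElement_of fun c _ M hM h1 => ?_
  obtain ⟨ε, -, hε⟩ := exists_adjoin_lt_one M 0 hM h1
  rw [smul_zero] at hε ⊢
  exact hε.le

theorem IsTensorRadicalElement.add (ha : IsTensorRadicalElement a)
    (hb : IsTensorRadicalElement b) : IsTensorRadicalElement (a + b) := by
  intro M hM
  refine le_antisymm ?_ (tensorRadius_le_adjoin M _)
  refine (tensorRadius_adjoin_add_le M a b).trans ?_
  rw [ha.eq ((Equiv.sumComm Unit ℕ).trans Equiv.natSumPUnitEquivNat).symm (isSummableFamily_adjoin M b hM), hb M hM]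

/-- The common part of the two multiplicative closure properties. -/
theorem IsTensorRadicalElement.exists_family (ha : IsTensorRadicalElement a) (b : A) (M : ℕ → A)
    (hM : IsSummableFamily M) (h1 : tensorRadius M < 1) (c : ℂ) (hc : c ≠ 0) :
    ∃ a' b' : A, c • (a * b) = a' * b' ∧ c • (b * a) = b' * a' ∧
      totalSum (adjoin a' (adjoin b' M)) < ∞ := by
  obtain ⟨ε, h0, hε⟩ := exists_adjoin_lt_one M b hM h1
  have hε0 : (ε : ℂ) ≠ 0 := by exact_mod_cast h0.ne'
  have hk : c * (ε : ℂ)⁻¹ ≠ 0 := mul_ne_zero hc (inv_ne_zero hε0)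
  have hce : (ε : ℂ) * (c * (ε : ℂ)⁻¹) = c := by field_simp
  refine ⟨(c * (ε : ℂ)⁻¹) • a, (ε : ℂ) • b, ?_, ?_, ?_⟩
  · rw [mul_smul_comm, smul_mul_assoc, smul_smul, hce]
  · rw [mul_smul_comm, smul_mul_assoc, smul_smul, mul_comm, hce]
  · have hS := isSummableFamily_adjoin M ((ε : ℂ) • b) hM
    refine totalSum_lt_top _ (isSummableFamily_adjoin _ _ hS) ?_
    rw [(ha.smul hk).eq ((Equiv.sumComm Unit ℕ).trans Equiv.natSumPUnitEquivNat).symm hS]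
    exact hε

theorem IsTensorRadicalElement.mul_right (ha : IsTensorRadicalElement a) (b : A) :
    IsTensorRadicalElement (a * b) := by
  refine isTensorRadicalElement_of fun c hc M hM h1 => ?_
  obtain ⟨a', b', h, -, hN⟩ := ha.exists_family b M hM h1 c hc
  exact tensorRadius_adjoin_mul_le M (adjoin a' (adjoin b' M)) _ (fun i => Sum.inr (Sum.inr i))
    (Sum.inr_injective.comp Sum.inr_injective) (fun _ => rfl) (Sum.inl ()) (Sum.inr (Sum.inl ()))
    (by simp) h hN

theorem IsTensorRadicalElement.mul_left (ha : IsTensorRadicalElement a) (b : A) :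
    IsTensorRadicalElement (b * a) := by
  refine isTensorRadicalElement_of fun c hc M hM h1 => ?_
  obtain ⟨a', b', -, h, hN⟩ := ha.exists_family b M hM h1 c hc
  exact tensorRadius_adjoin_mul_le M (adjoin a' (adjoin b' M)) _ (fun i => Sum.inr (Sum.inr i))
    (Sum.inr_injective.comp Sum.inr_injective) (fun _ => rfl) (Sum.inr (Sum.inl ())) (Sum.inl ())
    (by simp) h hN

end Homogeneity

end TensorRadius
/-- The tensor Jacobson radical. -/
def tensorJacobsonRadical : IdealMap.{u} := fun A _ _ _ _ =>
  { carrier := {a : A | IsTensorRadicalElement a}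
    zero_mem' := isTensorRadicalElement_zero
    add_mem' := fun ha hb => ha.add hb
    smul_mem' := fun c a ha => by
      rcases eq_or_ne c 0 with rfl | hc
      · change IsTensorRadicalElement ((0 : ℂ) • a)
        rw [zero_smul]
        exact isTensorRadicalElement_zero
      · exact ha.smul hc
    mul_mem_left := fun b _ ha => ha.mul_left b
    mul_mem_right := fun b _ ha => ha.mul_right b }

end NormedRadical

/-! Write R for the tensor radical. The analytic basis is a second description of it: a lies in R(A)
exactly when the family aM has tensor radius zero for every summable family M
(`IsTensorRadicalElement.tensorRadius_mul_left` and
`isTensorRadicalElement_of_tensorRadius_mul_left`). It is obtained by counting words: a radius below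
1 makes the sum of the norms of all words finite, and words in a disjoint union can be cut into
blocks.

This description yields that summable families inside R have radius zero and may be added to other
summable families without raising the radius, that R is closed and hereditary, that A/R is
semiprime, that R is compatible with completions, and that the radius of a summable family is
controlled by its radius modulo R.

Semiprimeness turns the centralization into something explicit. In a semiprime algebra a commutative
ideal is central and annihilates all commutators, and the elements with these two properties form a
commutative ideal, so this ideal is the sum of all commutative ideals
(`AlgIdeal.comap_sumCommIdeals`). Hence x lies in the centralization if and only if all xa - ax and
all x(ab - ba) lie in R(A), and each claim becomes a claim about R for elements of these two shapes.
Maximality, closedness, uniformity, images under open maps and passage to the completion follow from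
the matching properties of R.

Two points need more. For heredity, the conditions tested on an ideal must be extended to the whole
algebra, which is again semiprime algebra (`AlgIdeal.IsCentralMod.of_ideal`). For the vanishing on
the quotient by the centralization Z, an element y with Zy inside R(A) and image in R(A/Z) must lie
in R(A) (`mem_tensorJacobsonRadical_of_quotient`); it applies because Z annihilates commutators
modulo R(A). -/

namespace NormedRadical

/-! ### Word sums: rearrangement, block decomposition, powers and refinement of families. -/

section Families

variable {A : Type u} [NonUnitalNormedRing A] {ι κ : Type}

theorem wordSum_zero_right (M : ι → A) (n : ℕ) : wordSum M n 0 = 0 := by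
  induction n with
  | zero => exact enorm_zero
  | succ n ih =>
    change ∑' i, wordSum M n (0 * M i) = 0
    simp [ih]

/-- The sums of words depend only on the nonzero members of a family, with multiplicity. -/
theorem wordSum_congr {M : ι → A} {N : κ → A}
    (h : ∀ F : A → ℝ≥0∞, F 0 = 0 → ∑' i, F (M i) = ∑' k, F (N k)) (n : ℕ) :
    ∀ x, wordSum M n x = wordSum N n x := by
  induction n with
  | zero => intro x; rfl
  | succ n ih =>
    intro x
    change ∑' i, wordSum M n (x * M i) = ∑' k, wordSum N n (x * N k)
    simp_rw [ih]
    exact h (fun y => wordSum N n (x * y)) (by simp [wordSum_zero_right])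

theorem tensorRadius_congr {M : ι → A} {N : κ → A}
    (h : ∀ F : A → ℝ≥0∞, F 0 = 0 → ∑' i, F (M i) = ∑' k, F (N k)) :
    tensorRadius M = tensorRadius N := by
  unfold tensorRadius
  simp_rw [familyNorm_pow, wordSum_congr h]
  refine iInf_congr fun n => ?_
  rw [h _ (wordSum_zero_right N n)]

/-- A summable family may be replaced by a sequence. -/
theorem IsSummableFamily.exists_nat {M : ι → A} (hM : IsSummableFamily M) :
    ∃ N : ℕ → A, ∀ F : A → ℝ≥0∞, F 0 = 0 → ∑' i, F (M i) = ∑' k, F (N k) := by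
  have hc : (Function.support fun i => ‖M i‖ₑ).Countable :=
    Summable.countable_support_ennreal (ne_of_lt hM)
  set S := Function.support fun i => ‖M i‖ₑ with hS
  have := hc.to_subtype
  obtain ⟨g, hg⟩ := exists_injective_nat S
  -- A finite norm leaves only countably many nonzero members. The zeros that fill the unused
  -- indices are invisible to `F`, since `F 0 = 0`.
  refine ⟨Function.extend g (fun s : S => M s) 0, fun F hF => ?_⟩
  have h1 : ∑' s : S, F (M s) = ∑' i, F (M i) := by
    refine tsum_subtype_eq_of_support_subset (f := fun i => F (M i)) fun i hi hn => hi ?_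
    have h0 : M i = 0 := by simpa using hn
    change F (M i) = 0
    rw [h0, hF]
  rw [← h1, ← hg.tsum_eq]
  · simp [hg.extend_apply]
  · intro k hk
    by_contra hn
    refine hk ?_
    change F _ = 0
    rw [Function.extend_apply' _ _ _ fun ⟨s, hs⟩ => hn ⟨s, hs⟩]
    exact hF

theorem tsum_sumElim (N : κ → A) (M : ι → A) (F : A → ℝ≥0∞) :
    ∑' s, F (Sum.elim N M s) = ∑' k, F (N k) + ∑' i, F (M i) := by
  rw [ENNReal.summable.tsum_sum ENNReal.summable]
  rfl

theorem familyNorm_sumElim (N : κ → A) (M : ι → A) :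
    familyNorm (Sum.elim N M) = familyNorm N + familyNorm M :=
  tsum_sumElim N M fun x => ‖x‖ₑ

theorem IsSummableFamily.sumElim {N : κ → A} {M : ι → A} (hN : IsSummableFamily N)
    (hM : IsSummableFamily M) : IsSummableFamily (Sum.elim N M) := by
  unfold IsSummableFamily
  rw [familyNorm_sumElim]
  exact ENNReal.add_lt_top.2 ⟨hN, hM⟩

theorem familyNorm_mul_le (N : κ → A) (M : ι → A) :
    familyNorm (familyMul N M) ≤ familyNorm N * familyNorm M := by
  unfold familyNorm familyMul
  rw [ENNReal.tsum_prod', ← ENNReal.tsum_mul_right]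
  refine ENNReal.tsum_le_tsum fun k => ?_
  rw [← ENNReal.tsum_mul_left]
  exact ENNReal.tsum_le_tsum fun i => enorm_mul_le_mul _ _

theorem IsSummableFamily.familyMul {N : κ → A} {M : ι → A} (hN : IsSummableFamily N)
    (hM : IsSummableFamily M) : IsSummableFamily (familyMul N M) :=
  (familyNorm_mul_le N M).trans_lt (ENNReal.mul_lt_top hN hM)

theorem familyNorm_mul_left_le (a : A) (M : ι → A) :
    familyNorm (fun i => a * M i) ≤ ‖a‖ₑ * familyNorm M := by
  unfold familyNorm
  rw [← ENNReal.tsum_mul_left]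
  exact ENNReal.tsum_le_tsum fun i => enorm_mul_le_mul _ _

theorem IsSummableFamily.mul_left {M : ι → A} (hM : IsSummableFamily M) (a : A) :
    IsSummableFamily fun i => a * M i :=
  (familyNorm_mul_left_le a M).trans_lt (ENNReal.mul_lt_top enorm_lt_top hM)

theorem tensorRadius_le_familyNorm (M : ι → A) : tensorRadius M ≤ familyNorm M := by
  refine (iInf_le _ 0).trans ?_
  simp only [Nat.cast_zero, zero_add, div_one, ENNReal.rpow_one]
  exact le_rfl

/-- `allWords M` is the least supersolution of its recursion. -/
theorem allWords_le_of_supersolution (M : ι → A) (Φ : A → ℝ≥0∞)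
    (h : ∀ x, ‖x‖ₑ + ∑' i, Φ (x * M i) ≤ Φ x) (x : A) : allWords M x ≤ Φ x := by
  have key : ∀ K x, ∑ n ∈ Finset.range K, wordSum M n x ≤ Φ x := by
    intro K
    induction K with
    | zero => intro x; simp
    | succ K ih =>
      intro x
      rw [Finset.sum_range_succ', add_comm]
      refine le_trans (add_le_add le_rfl ?_) (h x)
      change ∑ n ∈ Finset.range K, ∑' i, wordSum M n (x * M i) ≤ _
      rw [← Summable.tsum_finsetSum fun _ _ => ENNReal.summable]
      exact ENNReal.tsum_le_tsum fun i => ih _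
  exact ENNReal.tsum_le_of_sum_range_le fun K => key K x

theorem allWords_le (M : ι → A) (x : A) : allWords M x ≤ (1 + totalSum M) * ‖x‖ₑ := by
  unfold allWords totalSum
  rw [tsum_eq_zero_add' ENNReal.summable, add_mul, one_mul, ← ENNReal.tsum_mul_right]
  exact add_le_add le_rfl (ENNReal.tsum_le_tsum fun n => wordSum_succ_le M n x)

/-- The family of all nonempty words in a family. -/
def starFamily (M : ι → A) : (Σ n, PowIndex ι n) → A := fun s => familyPow M s.1 s.2

theorem familyNorm_starFamily (M : ι → A) : familyNorm (starFamily M) = totalSum M :=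
  ENNReal.tsum_sigma' _

/-- A nonempty word is a single letter or a letter followed by a nonempty word. -/
theorem tsum_starFamily (M : ι → A) (G : A → ℝ≥0∞) :
    ∑' s, G (starFamily M s) = ∑' i, (G (M i) + ∑' s, G (M i * starFamily M s)) := by
  rw [ENNReal.tsum_sigma', tsum_eq_zero_add' ENNReal.summable, ENNReal.tsum_add]
  congr 1
  simp_rw [ENNReal.tsum_sigma']
  rw [ENNReal.tsum_comm]
  refine tsum_congr fun n => ?_
  exact ENNReal.tsum_prod' (f := fun p : ι × PowIndex ι n => G (M p.1 * familyPow M n p.2))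

/-- Adjoining a family `N` to `M` is controlled by the family of the words that consist of a letter
from `N` followed by letters from `M`. -/
theorem tensorRadius_sumElim_le_one (N : κ → A) (M : ι → A) (hN : IsSummableFamily N)
    (hM : IsSummableFamily M) (hr : tensorRadius M < 1)
    (hE : tensorRadius (Sum.elim N (familyMul N (starFamily M))) < 1) :
    tensorRadius (Sum.elim N M) ≤ 1 := by
  have hT : totalSum M < ∞ := totalSum_lt_top M hM hr
  have hS : IsSummableFamily (starFamily M) := by
    unfold IsSummableFamily
    rwa [familyNorm_starFamily]
  set E := Sum.elim N (familyMul N (starFamily M)) with hEdef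
  have hTE : totalSum E < ∞ := totalSum_lt_top E (hN.sumElim (hN.familyMul hS)) hE
  -- A word in the union is uniquely a possibly empty word in `M` followed by blocks, each block a
  -- letter of `N` with the letters of `M` after it. The blocks are the members of `E`, so `Φ x`
  -- sums the norms of `x w` over all words `w` of the union.
  set Φ : A → ℝ≥0∞ := fun x => allWords E x + ∑' s, allWords E (x * starFamily M s) with hΦ
  -- Split off the letter of `N` that opens the first block; what follows is a word in `M` and then
  -- further blocks.
  have hG : ∀ x, allWords E x = ‖x‖ₑ + ∑' k, Φ (x * N k) := by
    intro x
    rw [allWords_eq, tsum_sumElim N (familyMul N (starFamily M)) fun y => allWords E (x * y),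
      hΦ, ENNReal.tsum_add]
    congr 2
    refine (ENNReal.tsum_prod'
      (f := fun p => allWords E (x * (N p.1 * starFamily M p.2)))).trans ?_
    simp_rw [mul_assoc]
  have hsup : ∀ x, ‖x‖ₑ + ∑' s, Φ (x * Sum.elim N M s) ≤ Φ x := by
    intro x
    rw [tsum_sumElim N M fun y => Φ (x * y), ← add_assoc, ← hG]
    refine add_le_add le_rfl ?_
    rw [tsum_starFamily M fun y => allWords E (x * y)]
    simp_rw [← mul_assoc]
    exact le_rfl
  have hbound : ∀ x, Φ x ≤ (1 + totalSum E) * (1 + totalSum M) * ‖x‖ₑ := by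
    intro x
    calc Φ x ≤ (1 + totalSum E) * ‖x‖ₑ +
          ∑' s, (1 + totalSum E) * ‖x‖ₑ * ‖starFamily M s‖ₑ := by
            refine add_le_add (allWords_le E x) (ENNReal.tsum_le_tsum fun s => ?_)
            refine (allWords_le E _).trans ?_
            rw [mul_assoc]
            gcongr
            exact enorm_mul_le_mul _ _
      _ = _ := by
            rw [ENNReal.tsum_mul_left]
            change _ + _ * familyNorm (starFamily M) = _
            rw [familyNorm_starFamily]
            ring
  refine tensorRadius_le_one _ (lt_of_le_of_lt (b := (1 + totalSum E) * (1 + totalSum M) *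
    familyNorm (Sum.elim N M)) ?_ ?_)
  · rw [totalSum_eq, familyNorm, ← ENNReal.tsum_mul_left]
    exact ENNReal.tsum_le_tsum fun s =>
      (allWords_le_of_supersolution _ Φ hsup _).trans (hbound _)
  · exact ENNReal.mul_lt_top (ENNReal.mul_lt_top (by simp [hTE]) (by simp [hT]))
      (hN.sumElim hM)

theorem tsum_wordSum_familyPow_mul (M : ι → A) (j k : ℕ) :
    ∀ x, ∑' p, wordSum M j (x * familyPow M k p) = wordSum M (k + 1 + j) x := by
  induction k with
  | zero =>
    intro x
    rw [zero_add, add_comm]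
    rfl
  | succ k ih =>
    intro x
    refine (ENNReal.tsum_prod'
      (f := fun p : ι × PowIndex ι k => wordSum M j (x * (M p.1 * familyPow M k p.2)))).trans ?_
    rw [show k + 1 + 1 + j = (k + 1 + j) + 1 by ring]
    change _ = ∑' i, wordSum M (k + 1 + j) (x * M i)
    simp_rw [← ih, mul_assoc]

theorem tsum_wordSum_familyPow (M : ι → A) (j k : ℕ) :
    ∑' p, wordSum M j (familyPow M k p) = ∑' i, wordSum M (k + j) (M i) := by
  cases k with
  | zero => rw [zero_add]; rfl
  | succ k =>
    refine (ENNReal.tsum_prod'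
      (f := fun p : ι × PowIndex ι k => wordSum M j (M p.1 * familyPow M k p.2))).trans ?_
    exact tsum_congr fun i => tsum_wordSum_familyPow_mul M j k (M i)

theorem wordSum_familyPow (M : ι → A) (k n : ℕ) :
    ∀ x, wordSum (familyPow M k) n x = wordSum M ((k + 1) * n) x := by
  induction n with
  | zero => intro x; rfl
  | succ n ih =>
    intro x
    change ∑' p, wordSum (familyPow M k) n (x * familyPow M k p) = _
    simp_rw [ih]
    rw [tsum_wordSum_familyPow_mul]
    congr 1
    ring

theorem familyNorm_familyPow_familyPow (M : ι → A) (k n : ℕ) :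
    familyNorm (familyPow (familyPow M k) n) =
      familyNorm (familyPow M (k + (k + 1) * n)) := by
  rw [familyNorm_pow, familyNorm_pow]
  simp_rw [wordSum_familyPow]
  exact tsum_wordSum_familyPow M _ k

/-- The powers of a power of `M` are again powers of `M`, so the infimum on the right runs over some
of the exponents used on the left. -/
theorem tensorRadius_pow_le (M : ι → A) (k : ℕ) :
    tensorRadius M ^ (k + 1) ≤ tensorRadius (familyPow M k) := by
  refine le_iInf fun n => ?_
  rw [familyNorm_familyPow_familyPow]
  refine (pow_le_pow_left' (iInf_le _ (k + (k + 1) * n)) (k + 1)).trans_eq ?_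
  rw [← ENNReal.rpow_natCast, ← ENNReal.rpow_mul]
  congr 1
  push_cast
  -- Indices are exponents minus one: this is the product of the exponents `k + 1` and `n + 1`.
  have h1 : (k : ℝ) + (k + 1) * n + 1 = (k + 1) * (n + 1) := by ring
  rw [h1]
  field_simp

theorem tensorRadius_le_one_of_familyPow {M : ι → A} (k : ℕ)
    (h : tensorRadius (familyPow M k) ≤ 1) : tensorRadius M ≤ 1 :=
  (pow_le_one_iff k.succ_ne_zero).1 ((tensorRadius_pow_le M k).trans h)

theorem tensorRadius_eq_zero_of_familyPow {M : ι → A} (k : ℕ)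
    (h : tensorRadius (familyPow M k) = 0) : tensorRadius M = 0 :=
  eq_zero_of_pow_eq_zero (le_zero_iff.1 ((tensorRadius_pow_le M k).trans_eq h))

theorem enorm_le_tsum_of_hasSum {y : κ → A} {x : A} (h : HasSum y x) : ‖x‖ₑ ≤ ∑' k, ‖y k‖ₑ :=
  le_of_tendsto (h.enorm) (Filter.Eventually.of_forall fun s =>
    (enorm_sum_le _ _).trans (ENNReal.sum_le_tsum s))

theorem wordSum_le_of_hasSum (M : ι → A) (n : ℕ) : ∀ {y : κ → A} {x : A}, HasSum y x →
    wordSum M n x ≤ ∑' k, wordSum M n (y k) := by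
  induction n with
  | zero => intro y x h; exact enorm_le_tsum_of_hasSum h
  | succ n ih =>
    intro y x h
    change ∑' i, wordSum M n (x * M i) ≤ ∑' k, ∑' i, wordSum M n (y k * M i)
    rw [ENNReal.tsum_comm]
    exact ENNReal.tsum_le_tsum fun i => ih (h.mul_right (M i))

/-- Expand every letter of a word into its series and use the triangle inequality for convergent
sums, one letter at a time. -/
theorem wordSum_le_refinement {M : ι → A} {N : ι × κ → A}
    (h : ∀ i, HasSum (fun k => N (i, k)) (M i)) (n : ℕ) :
    ∀ x, wordSum M n x ≤ wordSum N n x := by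
  induction n with
  | zero => intro x; exact le_rfl
  | succ n ih =>
    intro x
    change ∑' i, wordSum M n (x * M i) ≤ ∑' p, wordSum N n (x * N p)
    rw [ENNReal.tsum_prod']
    exact ENNReal.tsum_le_tsum fun i =>
      (ih _).trans (wordSum_le_of_hasSum N n ((h i).mul_left x))

/-- The tensor radius does not decrease if each member of a family is split into a sum. -/
theorem tensorRadius_le_refinement {M : ι → A} {N : ι × κ → A}
    (h : ∀ i, HasSum (fun k => N (i, k)) (M i)) : tensorRadius M ≤ tensorRadius N := by
  refine iInf_mono fun n => ENNReal.rpow_le_rpow ?_ (by positivity)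
  rw [familyNorm_pow, familyNorm_pow, ENNReal.tsum_prod']
  exact ENNReal.tsum_le_tsum fun i =>
    (wordSum_le_refinement h n _).trans (wordSum_le_of_hasSum N n (h i))

theorem tensorRadius_add_le (N M : ι → A) :
    tensorRadius (fun i => N i + M i) ≤ tensorRadius (Sum.elim N M) := by
  -- Each member is a two-term series indexed by `Bool`; the refined family is a rearrangement of
  -- the disjoint union.
  refine (tensorRadius_le_refinement (N := fun p : ι × Bool => bif p.2 then N p.1 else M p.1)
    fun i => ?_).trans_eq (tensorRadius_congr fun F _ => ?_)
  · simpa using hasSum_fintype fun b : Bool => bif b then N i else M i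
  · rw [tsum_sumElim, ENNReal.tsum_prod', ← ENNReal.tsum_add]
    exact tsum_congr fun i => by simp [tsum_fintype]

end Families

/-! ### The tensor radical through left multiples of families, and its first consequences. -/

section Scaling

variable {A : Type u} [NonUnitalNormedRing A] [NormedSpace ℂ A] [IsScalarTower ℂ A A]
  [SMulCommClass ℂ A A] {B : Type u} [NonUnitalNormedRing B] [NormedSpace ℂ B]
  [IsScalarTower ℂ B B] [SMulCommClass ℂ B B] {ι κ : Type}

/-- By homogeneity only the threshold 1 matters: scale by the inverse of a number strictly above the
radius of `N`. -/
theorem tensorRadius_le_of_smul {M : ι → A} {N : κ → B}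
    (h : ∀ c : ℂ, c ≠ 0 → tensorRadius (c • N) < 1 → tensorRadius (c • M) ≤ 1) :
    tensorRadius M ≤ tensorRadius N := by
  refine le_of_forall_gt fun r hr => ?_
  obtain ⟨q, hq, hqr⟩ := ENNReal.lt_iff_exists_nnreal_btwn.1 hr
  refine lt_of_le_of_lt ?_ hqr
  have hq0 : q ≠ 0 := by
    rintro rfl
    simp at hq
  have hc : (((q : ℝ)⁻¹ : ℝ) : ℂ) ≠ 0 := by simpa using hq0
  have hn : ‖(((q : ℝ)⁻¹ : ℝ) : ℂ)‖ₑ = (q : ℝ≥0∞)⁻¹ := by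
    rw [← ofReal_norm, Complex.norm_real, Real.norm_of_nonneg (by positivity),
      ENNReal.ofReal_inv_of_pos (by positivity), ENNReal.ofReal_coe_nnreal]
  have h1 : tensorRadius ((((q : ℝ)⁻¹ : ℝ) : ℂ) • N) < 1 := by
    rw [tensorRadius_smul N hc, hn, mul_comm, ← div_eq_mul_inv]
    exact ENNReal.div_lt_of_lt_mul (by simpa using hq)
  have h2 := h _ hc h1
  rw [tensorRadius_smul _ hc, hn, mul_comm, ← div_eq_mul_inv] at h2
  simpa using (ENNReal.div_le_iff (by simpa using hq0) ENNReal.coe_ne_top).1 h2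

theorem tensorRadius_eq_zero_of_smul {M : ι → A}
    (h : ∀ c : ℂ, c ≠ 0 → tensorRadius (c • M) ≤ 1) : tensorRadius M = 0 := by
  have h0 : tensorRadius (0 : Unit → A) = 0 :=
    le_zero_iff.1 ((tensorRadius_le_familyNorm _).trans_eq (by simp [familyNorm]))
  exact le_zero_iff.1 ((tensorRadius_le_of_smul fun c hc _ => h c hc).trans_eq h0)

theorem exists_smul_familyNorm_lt_one {M : ι → A} (hM : IsSummableFamily M) :
    ∃ d : ℂ, d ≠ 0 ∧ familyNorm (d • M) < 1 := by
  lift familyNorm M to NNReal using ne_of_lt hM with q hq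
  refine ⟨(((q + 1 : ℝ)⁻¹ : ℝ) : ℂ), ?_, ?_⟩
  · have : (q + 1 : ℝ) ≠ 0 := by positivity
    exact_mod_cast inv_ne_zero this
  · have h := familyNorm_pow_smul M (((q + 1 : ℝ)⁻¹ : ℝ) : ℂ) 0
    change familyNorm ((((q + 1 : ℝ)⁻¹ : ℝ) : ℂ) • M) = _ * familyNorm M at h
    rw [h, ← hq, zero_add, pow_one, ← ofReal_norm, Complex.norm_real,
      Real.norm_of_nonneg (by positivity), ← ENNReal.ofReal_coe_nnreal,
      ← ENNReal.ofReal_mul (by positivity), ENNReal.ofReal_lt_one, inv_mul_lt_iff₀ (by positivity)]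
    linarith

/-- A word in the family `a * M i` is a word of twice the length in `a` and the letters of `M`, and
different words remain different. -/
theorem totalSum_mul_left_le (a : A) (M : ι → A) :
    totalSum (fun i => a * M i) ≤ totalSum (adjoin a M) := by
  have step : ∀ x, ‖x‖ₑ + ∑' i, allWords (adjoin a M) (x * (a * M i)) ≤
      allWords (adjoin a M) x := by
    intro x
    rw [allWords_eq (adjoin a M) x, tsum_adjoin a M fun y => allWords (adjoin a M) (x * y)]
    gcongr
    refine le_trans ?_ le_self_add
    rw [allWords_eq (adjoin a M) (x * a),
      tsum_adjoin a M fun y => allWords (adjoin a M) (x * a * y)]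
    simp_rw [← mul_assoc]
    exact (le_add_self.trans le_add_self)
  rw [totalSum_eq, totalSum_eq, tsum_adjoin a M fun y => allWords (adjoin a M) y]
  refine le_trans ?_ le_self_add
  rw [allWords_eq (adjoin a M) a, tsum_adjoin a M fun y => allWords (adjoin a M) (a * y)]
  refine le_trans (ENNReal.tsum_le_tsum fun i => ?_) (le_add_self.trans le_add_self)
  exact allWords_le_of_supersolution _ _ step _

/-- Adjoining any multiple of `a` to a family of norm below 1 keeps the sum over all words finite.
Arbitrarily large multiples of the family of products therefore have radius at most 1. -/
theorem IsTensorRadicalElement.tensorRadius_mul_left {a : A} (ha : IsTensorRadicalElement a)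
    {M : ι → A} (hM : IsSummableFamily M) : tensorRadius (fun i => a * M i) = 0 := by
  obtain ⟨N, hN⟩ := hM.exists_nat
  have hNs : IsSummableFamily N := by
    unfold IsSummableFamily familyNorm
    rw [← hN (fun x => ‖x‖ₑ) enorm_zero]
    exact hM
  rw [tensorRadius_congr (N := fun k => a * N k) fun F hF => hN (fun x => F (a * x)) (by simpa)]
  refine tensorRadius_eq_zero_of_smul fun c hc => ?_
  obtain ⟨d, hd, hd1⟩ := exists_smul_familyNorm_lt_one hNs
  have hdN := isSummableFamily_smul N d hNs
  have hr := (ha.smul (div_ne_zero hc hd)) _ hdN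
  have hlt : tensorRadius (adjoin ((c / d) • a) (d • N)) < 1 := by
    rw [hr]
    exact (tensorRadius_le_familyNorm _).trans_lt hd1
  have heq : (c • fun k => a * N k) = fun k => ((c / d) • a) * (d • N) k := by
    funext k
    simp only [Pi.smul_apply]
    rw [smul_mul_smul_comm, div_mul_cancel₀ _ hd]
  rw [heq]
  exact tensorRadius_le_one _ ((totalSum_mul_left_le _ _).trans_lt
    (totalSum_lt_top _ (isSummableFamily_adjoin _ _ hdN) hlt))

/-- By the block decomposition it is enough that the blocks starting with a multiple `b` of `a` have
radius below 1. The block `b` alone need not be a product with left factor `b`, but every product of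
two blocks is, so the square of the block family has radius zero. -/
theorem isTensorRadicalElement_of_tensorRadius_mul_left {a : A}
    (h : ∀ (ι : Type) (M : ι → A), IsSummableFamily M → tensorRadius (fun i => a * M i) = 0) :
    IsTensorRadicalElement a := by
  have hsmul : ∀ c : ℂ, ∀ (ι : Type) (M : ι → A), IsSummableFamily M →
      tensorRadius (fun i => c • a * M i) = 0 := by
    intro c ι M hM
    simp_rw [smul_mul_assoc, ← mul_smul_comm]
    exact h ι (c • M) (isSummableFamily_smul M c hM)
  refine isTensorRadicalElement_of fun c hc M hM hr => ?_
  set b := c • a with hb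
  have hS : IsSummableFamily (starFamily M) := by
    unfold IsSummableFamily
    rw [familyNorm_starFamily]
    exact totalSum_lt_top M hM hr
  have hN : IsSummableFamily fun _ : Unit => b := by
    simp [IsSummableFamily, familyNorm]
  refine tensorRadius_sumElim_le_one (fun _ : Unit => b) M hN hM hr ?_
  set E := Sum.elim (fun _ : Unit => b) (familyMul (fun _ : Unit => b) (starFamily M)) with hE
  have hEs : IsSummableFamily E := hN.sumElim (hN.familyMul hS)
  -- What remains of a product of two blocks once the leading `b` is removed. The index type is that
  -- of the square, so that the families can be compared member by member.
  let N' : PowIndex (Unit ⊕ Unit × (Σ n, PowIndex ℕ n)) 1 → A := fun p =>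
    Sum.elim (fun _ : Unit => E p.2) (fun s => starFamily M s.2 * E p.2) p.1
  have hN' : IsSummableFamily N' := by
    have e : ∑' p, ‖N' p‖ₑ = familyNorm E +
        familyNorm (familyMul (fun s : Unit × _ => starFamily M s.2) E) := by
      refine (ENNReal.tsum_prod' (f := fun p => ‖N' p‖ₑ)).trans ?_
      rw [ENNReal.summable.tsum_sum ENNReal.summable, tsum_fintype, Fintype.sum_unique]
      congr 1
      exact (ENNReal.tsum_prod' (f := fun p : (Unit × _) × _ =>
        ‖starFamily M p.1.2 * E p.2‖ₑ)).symm
    unfold IsSummableFamily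
    rw [familyNorm, e]
    refine ENNReal.add_lt_top.2 ⟨hEs, IsSummableFamily.familyMul ?_ hEs⟩
    unfold IsSummableFamily familyNorm
    rw [ENNReal.tsum_prod', tsum_fintype, Fintype.sum_unique]
    exact hS
  have h2 : familyPow E 1 = fun p => b * N' p := by
    funext p
    obtain ⟨(_ | ⟨_, s⟩), p⟩ := p
    · rfl
    · exact mul_assoc _ _ _
  rw [tensorRadius_eq_zero_of_familyPow 1 (by rw [h2]; exact hsmul c _ N' hN')]
  exact zero_lt_one

theorem tensorRadius_nat_succ {N : ℕ → A} (h : IsTensorRadicalElement (N 0))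
    (hN : IsSummableFamily N) : tensorRadius N = tensorRadius fun k => N (k + 1) := by
  have hN' : IsSummableFamily fun k => N (k + 1) :=
    (ENNReal.tsum_comp_le_tsum_of_injective (add_left_injective 1) fun k => ‖N k‖ₑ).trans_lt hN
  rw [← h _ hN']
  refine tensorRadius_congr fun F _ => ?_
  rw [tsum_adjoin, tsum_eq_zero_add' ENNReal.summable]

/-- A summable family in the tensor radical has tensor radius zero. -/
theorem tensorRadius_eq_zero_of_forall_mem {N : ι → A} (hN : IsSummableFamily N)
    (h : ∀ i, N i ∈ tensorJacobsonRadical A) : tensorRadius N = 0 := by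
  classical
  obtain ⟨N', hN'⟩ := hN.exists_nat
  rw [tensorRadius_congr hN']
  have hs : IsSummableFamily N' := by
    unfold IsSummableFamily familyNorm
    rw [← hN' (fun x => ‖x‖ₑ) enorm_zero]
    exact hN
  have hR : ∀ k, N' k ∈ tensorJacobsonRadical A := by
    intro k
    by_contra hk
    -- This test function counts the members outside the radical.
    have h0 := hN' (fun x => if x ∈ tensorJacobsonRadical A then 0 else 1)
      (if_pos isTensorRadicalElement_zero)
    simp only [h, if_true, tsum_zero] at h0
    have := ENNReal.tsum_eq_zero.1 h0.symm k
    simp [hk] at this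
  -- Initial members can be deleted one at a time without changing the radius, while the norms of
  -- the tails tend to zero.
  have shift : ∀ m, IsSummableFamily (fun k => N' (k + m)) ∧
      tensorRadius N' = tensorRadius fun k => N' (k + m) := by
    intro m
    refine ⟨(ENNReal.tsum_comp_le_tsum_of_injective (add_left_injective m)
      fun k => ‖N' k‖ₑ).trans_lt hs, ?_⟩
    induction m with
    | zero => rfl
    | succ m ih =>
      rw [ih, tensorRadius_nat_succ (N := fun k => N' (k + m)) (hR _) ((ENNReal.tsum_comp_le_tsum_of_injective
        (add_left_injective m) fun k => ‖N' k‖ₑ).trans_lt hs)]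
      simp_rw [add_right_comm _ 1 m, add_assoc]
  refine le_zero_iff.1 (ge_of_tendsto (ENNReal.tendsto_sum_nat_add (fun k => ‖N' k‖ₑ) hs.ne)
    (Filter.Eventually.of_forall fun m => ?_))
  rw [(shift m).2]
  exact tensorRadius_le_familyNorm _

theorem smul_sumElim (c : ℂ) (N : κ → A) (M : ι → A) :
    c • Sum.elim N M = Sum.elim (c • N) (c • M) := by
  funext s
  rcases s with _ | _ <;> rfl

/-- Summable families in the tensor radical do not contribute to the tensor radius. -/
theorem tensorRadius_sumElim_le {N : κ → A} {M : ι → A} (hN : IsSummableFamily N)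
    (hM : IsSummableFamily M) (h : ∀ k, N k ∈ tensorJacobsonRadical A) :
    tensorRadius (Sum.elim N M) ≤ tensorRadius M := by
  refine tensorRadius_le_of_smul fun c hc hr => ?_
  rw [smul_sumElim]
  have hcN := isSummableFamily_smul N c hN
  have hcM := isSummableFamily_smul M c hM
  have hR : ∀ k, (c • N) k ∈ tensorJacobsonRadical A := fun k =>
    (tensorJacobsonRadical A).toSubmodule.smul_mem c (h k)
  refine tensorRadius_sumElim_le_one _ _ hcN hcM hr ?_
  have hS : IsSummableFamily (starFamily (c • M)) := by
    unfold IsSummableFamily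
    rw [familyNorm_starFamily]
    exact totalSum_lt_top _ hcM hr
  -- All blocks begin with a member of `c • N`, hence lie in the radical.
  rw [tensorRadius_eq_zero_of_forall_mem (hcN.sumElim (hcN.familyMul hS))]
  · exact zero_lt_one
  · rintro (k | ⟨k, s⟩)
    · exact hR k
    · exact (tensorJacobsonRadical A).mul_mem_right _ (hR k)

theorem tensorRadius_add_le_of_mem {N M : ι → A} (hN : IsSummableFamily N)
    (hM : IsSummableFamily M) (h : ∀ i, N i ∈ tensorJacobsonRadical A) :
    tensorRadius (fun i => N i + M i) ≤ tensorRadius M :=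
  (tensorRadius_add_le N M).trans (tensorRadius_sumElim_le hN hM h)

/-- For `b` in the radical close to `a`, the part `b M` of `a M = b M + (a - b) M` does not
contribute, and the other part has small norm. -/
theorem isClosed_tensorJacobsonRadical :
    IsClosed ((tensorJacobsonRadical A).toSubmodule : Set A) := by
  refine isClosed_of_closure_subset fun a ha => ?_
  refine isTensorRadicalElement_of_tensorRadius_mul_left fun ι M hM => ?_
  have hle : ∀ ε : ℝ≥0∞, 0 < ε → tensorRadius (fun i => a * M i) ≤ ε * familyNorm M := by
    intro ε hε
    obtain ⟨b, hb, hab⟩ := EMetric.mem_closure_iff.1 ha ε hε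
    have hb' : b ∈ tensorJacobsonRadical A := hb
    rw [edist_eq_enorm_sub] at hab
    have heq : (fun i => a * M i) = fun i => b * M i + (a - b) * M i := by
      funext i
      rw [sub_mul]
      abel
    rw [heq]
    refine (tensorRadius_add_le_of_mem (hM.mul_left b) (hM.mul_left (a - b))
      fun i => (tensorJacobsonRadical A).mul_mem_right _ hb').trans ?_
    refine (tensorRadius_le_familyNorm _).trans ((familyNorm_mul_left_le _ _).trans ?_)
    gcongr
  have lim : Filter.Tendsto (fun ε : ℝ≥0∞ => ε * familyNorm M) (nhdsWithin 0 (Set.Ioi 0))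
      (nhds 0) := by
    have h1 : Filter.Tendsto (fun ε : ℝ≥0∞ => ε) (nhdsWithin 0 (Set.Ioi 0)) (nhds 0) :=
      nhdsWithin_le_nhds
    simpa using ENNReal.Tendsto.mul_const h1 (Or.inr (ne_of_lt hM))
  exact le_zero_iff.1 (ge_of_tendsto lim (Filter.eventually_of_mem self_mem_nhdsWithin hle))

/-- The quotient by the tensor radical is semiprime. -/
theorem mem_tensorJacobsonRadical_of_mul_mul_mem {a : A}
    (h : ∀ c, a * c * a ∈ tensorJacobsonRadical A) : a ∈ tensorJacobsonRadical A := by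
  refine isTensorRadicalElement_of_tensorRadius_mul_left fun ι M hM => ?_
  refine tensorRadius_eq_zero_of_familyPow 1 (tensorRadius_eq_zero_of_forall_mem
    ((hM.mul_left a).familyMul (hM.mul_left a)) ?_)
  -- The square of the family consists of products `a m a m'`, which lie in the radical by
  -- hypothesis.
  rintro ⟨i, j⟩
  change a * M i * (a * M j) ∈ tensorJacobsonRadical A
  rw [← mul_assoc]
  exact (tensorJacobsonRadical A).mul_mem_right _ (h _)

theorem familyPow_comp (f : A →ₙₐ[ℂ] B) (M : ι → A) (n : ℕ) :
    familyPow (f ∘ M) n = f ∘ familyPow M n := by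
  induction n with
  | zero => rfl
  | succ n ih =>
    funext p
    change f (M p.1) * familyPow (f ∘ M) n p.2 = f (M p.1 * familyPow M n p.2)
    rw [ih, map_mul]
    rfl

theorem smul_comp (f : A →ₙₐ[ℂ] B) (M : ι → A) (c : ℂ) : c • (f ∘ M) = f ∘ (c • M) := by
  funext i
  exact (map_smul f c (M i)).symm

/-- The bound `C` is applied once to each whole word, not to each letter, so it only multiplies the
total sum and leaves its finiteness intact. -/
theorem tensorRadius_comp_le (f : A →ₙₐ[ℂ] B) {C : ℝ≥0∞} (hC : C ≠ ∞)
    (hf : ∀ x, ‖f x‖ₑ ≤ C * ‖x‖ₑ) {M : ι → A} (hM : IsSummableFamily M) :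
    tensorRadius (f ∘ M) ≤ tensorRadius M := by
  refine tensorRadius_le_of_smul fun c hc hr => ?_
  rw [smul_comp]
  have hT := totalSum_lt_top _ (isSummableFamily_smul M c hM) hr
  refine tensorRadius_le_one _ (lt_of_le_of_lt ?_ (ENNReal.mul_lt_top hC.lt_top hT))
  unfold totalSum
  rw [← ENNReal.tsum_mul_left]
  refine ENNReal.tsum_le_tsum fun n => ?_
  rw [familyPow_comp, familyNorm, familyNorm, ← ENNReal.tsum_mul_left]
  exact ENNReal.tsum_le_tsum fun p => hf _

theorem tensorRadius_comp_eq (f : A →ₙₐ[ℂ] B) (hf : ∀ x, ‖f x‖ₑ = ‖x‖ₑ) (M : ι → A) :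
    tensorRadius (f ∘ M) = tensorRadius M := by
  unfold tensorRadius familyNorm
  simp_rw [familyPow_comp, Function.comp_apply, hf]

theorem mem_tensorJacobsonRadical_of_isometry (f : A →ₙₐ[ℂ] B) (hf : ∀ x, ‖f x‖ₑ = ‖x‖ₑ) {a : A}
    (ha : f a ∈ tensorJacobsonRadical B) : a ∈ tensorJacobsonRadical A := by
  intro M hM
  have hM' : IsSummableFamily (f ∘ M) := by
    unfold IsSummableFamily familyNorm
    simp_rw [Function.comp_apply, hf]
    exact hM
  rw [← tensorRadius_comp_eq f hf, ← tensorRadius_comp_eq f hf M, ← ha _ hM']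
  congr 1
  funext s
  rcases s with _ | _ <;> rfl

/-- The tensor radical is mapped into the tensor radical by homomorphisms with controlled lifts. -/
theorem map_mem_tensorJacobsonRadical (f : A →ₙₐ[ℂ] B) {C D : ℝ≥0∞} (hC : C ≠ ∞) (hD : D ≠ ∞)
    (hf : ∀ x, ‖f x‖ₑ ≤ C * ‖x‖ₑ) (hl : ∀ y, ∃ x, f x = y ∧ ‖x‖ₑ ≤ D * ‖y‖ₑ) {a : A}
    (ha : a ∈ tensorJacobsonRadical A) : f a ∈ tensorJacobsonRadical B := by
  refine isTensorRadicalElement_of_tensorRadius_mul_left fun ι N hN => ?_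
  choose g hg hgn using hl
  have hM : IsSummableFamily (g ∘ N) := by
    refine lt_of_le_of_lt ?_ (ENNReal.mul_lt_top hD.lt_top hN)
    unfold familyNorm
    rw [← ENNReal.tsum_mul_left]
    exact ENNReal.tsum_le_tsum fun i => hgn _
  have h0 := IsTensorRadicalElement.tensorRadius_mul_left ha hM
  refine le_zero_iff.1 (le_trans (le_of_eq ?_)
    ((tensorRadius_comp_le f hC hf (hM.mul_left a)).trans_eq h0))
  congr 1
  funext i
  simp [hg]

end Scaling

/-! ### Quotient maps. -/

section AlgebraicQuotient

variable {A : Type u} [NonUnitalRing A] [Module ℂ A]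

theorem AlgIdeal.quotientMap_eq_iff {I : AlgIdeal A} {x y : A} :
    I.quotientMap x = I.quotientMap y ↔ x - y ∈ I :=
  Submodule.Quotient.eq I.toSubmodule

theorem AlgIdeal.quotientMap_eq_zero_iff {I : AlgIdeal A} {x : A} :
    I.quotientMap x = 0 ↔ x ∈ I :=
  Submodule.Quotient.mk_eq_zero I.toSubmodule

theorem AlgIdeal.quotientMap_surjective {I : AlgIdeal A} :
    Function.Surjective I.quotientMap :=
  Submodule.Quotient.mk_surjective I.toSubmodule

end AlgebraicQuotient

/-! ### The tensor radical and completions. -/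

section Completion

variable {A : Type u} [NonUnitalNormedRing A] [NormedSpace ℂ A] [IsScalarTower ℂ A A]
  [SMulCommClass ℂ A A]

theorem CompletionAlg.enorm_embedding (x : A) : ‖CompletionAlg.embedding A x‖ₑ = ‖x‖ₑ := by
  rw [← ofReal_norm, ← ofReal_norm]
  exact congrArg _ (CompletionAlg.norm_coe x)

/-- Every element of the completion is the sum of a series in the algebra with controlled norm. -/
theorem CompletionAlg.exists_hasSum (m : CompletionAlg A) :
    ∃ v : ℕ → A, HasSum (fun j => CompletionAlg.embedding A (v j)) m ∧
      ∑' j, ‖v j‖ₑ ≤ 4 * ‖m‖ₑ := by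
  rcases eq_or_ne m 0 with rfl | hm
  · exact ⟨0, by simp, by simp⟩
  have hm0 : 0 < ‖m‖ := norm_pos_iff.2 hm
  let j : A →+ CompletionAlg A := (CompletionAlg.embedding A : A →+ CompletionAlg A)
  have hmem : m ∈ closure (j.range : Set (CompletionAlg A)) := by
    have h := CompletionAlg.denseRange_coe (A := A) m
    exact h
  -- With errors `‖m‖ / 2 ^ n` the term `v 0` has norm at most `2 * ‖m‖`, and the geometric series
  -- doubles this to the constant 4.
  obtain ⟨v, hlim, h0, hv⟩ := controlled_sum_of_mem_closure_range hmem
    (f := fun n => ‖m‖ * (1 / 2) ^ n) fun n => by positivity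
  have hjn : ∀ x, ‖j x‖ = ‖x‖ := fun x => CompletionAlg.norm_coe x
  have hbound : ∀ n, ‖v n‖ ≤ 2 * ‖m‖ * (1 / 2) ^ n := by
    intro n
    rcases Nat.eq_zero_or_pos n with rfl | hn
    · simp only [pow_zero, mul_one] at h0 ⊢
      rw [← hjn]
      have h1 : j (v 0) = m - (-(j (v 0)) + m) := by abel
      calc ‖j (v 0)‖ = ‖m - (-(j (v 0)) + m)‖ := congrArg _ h1
        _ ≤ ‖m‖ + ‖-(j (v 0)) + m‖ := norm_sub_le _ _
        _ ≤ 2 * ‖m‖ := by linarith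
    · have := hv n hn
      rw [hjn] at this
      refine this.le.trans ?_
      gcongr
      linarith
  have hgeo : HasSum (fun n : ℕ => 2 * ‖m‖ * (1 / 2) ^ n) (2 * ‖m‖ * 2) :=
    hasSum_geometric_two.mul_left _
  refine ⟨v, ?_, ?_⟩
  · have hs : Summable fun n => j (v n) :=
      Summable.of_norm_bounded hgeo.summable fun n => by rw [hjn]; exact hbound n
    have h1 := hs.hasSum.tendsto_sum_nat.comp (Filter.tendsto_add_atTop_nat 1)
    have h2 := tendsto_nhds_unique h1 hlim
    have h3 := hs.hasSum
    rw [h2] at h3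
    exact h3
  · calc ∑' n, ‖v n‖ₑ ≤ ∑' n : ℕ, ENNReal.ofReal (2 * ‖m‖ * (1 / 2) ^ n) := by
          refine ENNReal.tsum_le_tsum fun n => ?_
          rw [← ofReal_norm]
          exact ENNReal.ofReal_le_ofReal (hbound n)
      _ = ENNReal.ofReal (2 * ‖m‖ * 2) := by
          rw [← ENNReal.ofReal_tsum_of_nonneg (fun n => by positivity) hgeo.summable,
            hgeo.tsum_eq]
      _ = 4 * ‖m‖ₑ := by
          rw [← ofReal_norm, show 2 * ‖m‖ * 2 = 4 * ‖m‖ by ring,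
            ENNReal.ofReal_mul (by norm_num)]
          norm_num

/-- `R_t A = A ∩ R_t Â`. -/
theorem embedding_mem_tensorJacobsonRadical {a : A} :
    CompletionAlg.embedding A a ∈ tensorJacobsonRadical (CompletionAlg A) ↔
      a ∈ tensorJacobsonRadical A := by
  refine ⟨mem_tensorJacobsonRadical_of_isometry _ CompletionAlg.enorm_embedding, fun ha => ?_⟩
  refine isTensorRadicalElement_of_tensorRadius_mul_left fun ι M hM => ?_
  -- Splitting the members of `M` into series from `A` gives a summable family in `A`, whose left
  -- multiple by `a` has radius zero; undoing the splitting cannot raise the radius.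
  choose v hv hvn using fun i => CompletionAlg.exists_hasSum (M i)
  let N : ι × ℕ → A := fun p => v p.1 p.2
  have hN : IsSummableFamily N := by
    unfold IsSummableFamily familyNorm
    rw [ENNReal.tsum_prod']
    refine (ENNReal.tsum_le_tsum hvn).trans_lt ?_
    rw [ENNReal.tsum_mul_left]
    exact ENNReal.mul_lt_top (by simp) hM
  have h0 := IsTensorRadicalElement.tensorRadius_mul_left ha hN
  rw [← tensorRadius_comp_eq _ CompletionAlg.enorm_embedding] at h0
  refine le_zero_iff.1 ((tensorRadius_le_refinement fun i => ?_).trans_eq h0)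
  simpa [N] using (hv i).mul_left (CompletionAlg.embedding A a)

end Completion

/-! ### Heredity, open maps and quotients for the tensor radical. -/

section Radical

variable {A : Type u} [NonUnitalNormedRing A] [NormedSpace ℂ A] [IsScalarTower ℂ A A]
  [SMulCommClass ℂ A A] {B : Type u} [NonUnitalNormedRing B] [NormedSpace ℂ B]
  [IsScalarTower ℂ B B] [SMulCommClass ℂ B B] {ι κ : Type}

theorem mem_tensorJacobsonRadical_subalgebra (S : NonUnitalSubalgebra ℂ A) {x : S}
    (hx : (x : A) ∈ tensorJacobsonRadical A) : x ∈ tensorJacobsonRadical S :=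
  mem_tensorJacobsonRadical_of_isometry (NonUnitalSubalgebraClass.subtype S) (fun _ => rfl) hx

/-- The tensor radical is hereditary. -/
theorem mem_tensorJacobsonRadical_ideal (I : AlgIdeal A) {x : I.toSubalgebra} :
    x ∈ tensorJacobsonRadical I.toSubalgebra ↔ (x : A) ∈ tensorJacobsonRadical A := by
  refine ⟨fun hx => ?_, mem_tensorJacobsonRadical_subalgebra _⟩
  refine isTensorRadicalElement_of_tensorRadius_mul_left fun ι M hM => ?_
  -- `M` need not lie in `I`, but in the square `(x m)(x m') = x (m x m')` the factor after the
  -- first `x` does.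
  let N : PowIndex ι 1 → I.toSubalgebra := fun p =>
    ⟨M p.1 * (x * M p.2), I.mul_mem_left _ (I.mul_mem_right _ x.2)⟩
  have hN : IsSummableFamily N := hM.familyMul (hM.mul_left (x : A))
  have h0 := IsTensorRadicalElement.tensorRadius_mul_left hx hN
  rw [← tensorRadius_comp_eq (NonUnitalSubalgebraClass.subtype I.toSubalgebra)
    fun _ => rfl] at h0
  refine tensorRadius_eq_zero_of_familyPow 1 ((congrArg tensorRadius ?_).trans h0)
  funext p
  exact mul_assoc _ _ _

theorem exists_enorm_le_of_isOpenMap (f : A →ₙₐ[ℂ] B) (hf : IsOpenMap f) :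
    ∃ D : ℝ≥0∞, D ≠ ∞ ∧ ∀ y, ∃ x, f x = y ∧ ‖x‖ₑ ≤ D * ‖y‖ₑ := by
  have h1 : f '' Metric.ball 0 1 ∈ nhds (0 : B) := by
    have := hf.image_mem_nhds (Metric.ball_mem_nhds (0 : A) one_pos)
    rwa [map_zero] at this
  obtain ⟨ε, hε, hsub⟩ := Metric.mem_nhds_iff.1 h1
  -- Rescale `y` to norm `ε / 2`, inside the ball covered by the image of the unit ball.
  refine ⟨ENNReal.ofReal (2 / ε), ENNReal.ofReal_ne_top, fun y => ?_⟩
  rcases eq_or_ne y 0 with rfl | hy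
  · exact ⟨0, map_zero f, by simp⟩
  have hy0 : 0 < ‖y‖ := norm_pos_iff.2 hy
  set t : ℝ := ε / (2 * ‖y‖) with ht
  have ht0 : 0 < t := by positivity
  have hty : ((t : ℝ) : ℂ) • y ∈ Metric.ball (0 : B) ε := by
    rw [mem_ball_zero_iff, norm_smul, Complex.norm_real, Real.norm_of_nonneg ht0.le]
    have : t * ‖y‖ = ε / 2 := by
      rw [ht]
      field_simp
    linarith
  obtain ⟨x, hx, hfx⟩ := hsub hty
  rw [mem_ball_zero_iff] at hx
  refine ⟨((t⁻¹ : ℝ) : ℂ) • x, ?_, ?_⟩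
  · rw [map_smul, hfx, smul_smul, ← Complex.ofReal_mul, inv_mul_cancel₀ ht0.ne',
      Complex.ofReal_one, one_smul]
  · rw [← ofReal_norm, ← ofReal_norm, ← ENNReal.ofReal_mul (by positivity), norm_smul,
      Complex.norm_real, Real.norm_of_nonneg (by positivity)]
    refine ENNReal.ofReal_le_ofReal ?_
    calc t⁻¹ * ‖x‖ ≤ t⁻¹ * 1 := by gcongr
      _ = 2 / ε * ‖y‖ := by
        rw [ht]
        field_simp

theorem exists_enorm_le_of_continuous (f : A →ₙₐ[ℂ] B) (hf : Continuous f) :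
    ∃ C : ℝ≥0∞, C ≠ ∞ ∧ ∀ x, ‖f x‖ₑ ≤ C * ‖x‖ₑ := by
  let g : A →L[ℂ] B := ⟨(f : A →ₗ[ℂ] B), hf⟩
  exact ⟨‖g‖ₑ, enorm_ne_top, fun x => g.le_opENorm x⟩

theorem map_mem_tensorJacobsonRadical_of_isOpenMap (f : A →ₙₐ[ℂ] B) (hc : Continuous f)
    (ho : IsOpenMap f) {a : A} (ha : a ∈ tensorJacobsonRadical A) :
    f a ∈ tensorJacobsonRadical B := by
  obtain ⟨C, hC, hCf⟩ := exists_enorm_le_of_continuous f hc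
  obtain ⟨D, hD, hDf⟩ := exists_enorm_le_of_isOpenMap f ho
  exact map_mem_tensorJacobsonRadical f hC hD hCf hDf ha

section Quotient

variable (I : AlgIdeal A) [IsClosed (I.toSubmodule : Set A)]

theorem AlgIdeal.enorm_quotientMap_le (x : A) : ‖I.quotientMap x‖ₑ ≤ ‖x‖ₑ := by
  rw [← ofReal_norm, ← ofReal_norm]
  exact ENNReal.ofReal_le_ofReal (Submodule.Quotient.norm_mk_le I.toSubmodule x)

theorem AlgIdeal.exists_lift (y : I.Quotient) :
    ∃ x, I.quotientMap x = y ∧ ‖x‖ₑ ≤ 2 * ‖y‖ₑ := by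
  rcases eq_or_ne y 0 with rfl | hy
  · exact ⟨0, map_zero _, by simp⟩
  obtain ⟨x, hx, hxn⟩ := Submodule.Quotient.norm_mk_lt y (norm_pos_iff.2 hy)
  refine ⟨x, hx, ?_⟩
  rw [← ofReal_norm, ← ofReal_norm, ← ENNReal.ofReal_ofNat 2, ← ENNReal.ofReal_mul (by norm_num)]
  exact ENNReal.ofReal_le_ofReal (by linarith)

/-- A summable family that is small modulo a closed ideal is a small perturbation of a family in
the ideal. -/
theorem AlgIdeal.exists_small_lift (M : ι → A) (h : 2 * familyNorm (I.quotientMap ∘ M) < 1) :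
    ∃ L : ι → A, familyNorm L < 1 ∧ ∀ i, M i - L i ∈ I := by
  choose L hL hLn using fun i => I.exists_lift (I.quotientMap (M i))
  refine ⟨L, lt_of_le_of_lt ?_ h, fun i => AlgIdeal.quotientMap_eq_iff.1 (hL i).symm⟩
  unfold familyNorm
  rw [← ENNReal.tsum_mul_left]
  exact ENNReal.tsum_le_tsum hLn

theorem IsSummableFamily.quotientMap {M : ι → A} (hM : IsSummableFamily M) :
    IsSummableFamily (I.quotientMap ∘ M) :=
  (ENNReal.tsum_le_tsum fun _ => I.enorm_quotientMap_le _).trans_lt hM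

/-- The norms of the powers are the terms of a convergent series. The factor 2 is the loss when
elements are lifted from a quotient. -/
theorem exists_two_mul_familyNorm_pow_lt_one {M : ι → A} (hM : IsSummableFamily M)
    (hr : tensorRadius M < 1) : ∃ n, 2 * familyNorm (familyPow M n) < 1 := by
  have h := ENNReal.tendsto_atTop_zero_of_tsum_ne_top (totalSum_lt_top M hM hr).ne
  have h2 := ENNReal.Tendsto.const_mul h (a := 2) (Or.inr (by simp))
  rw [mul_zero] at h2
  exact (h2.eventually_lt_const zero_lt_one).exists

theorem AlgIdeal.exists_pow_small_lift {M : ι → A} (hM : IsSummableFamily M)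
    (hr : tensorRadius (I.quotientMap ∘ M) < 1) : ∃ n, ∃ L : PowIndex ι n → A,
      familyNorm L < 1 ∧ ∀ p, familyPow M n p - L p ∈ I := by
  obtain ⟨n, hn⟩ := exists_two_mul_familyNorm_pow_lt_one (hM.quotientMap I) hr
  rw [familyPow_comp] at hn
  exact ⟨n, I.exists_small_lift _ hn⟩

end Quotient

instance : IsClosed ((tensorJacobsonRadical A).toSubmodule : Set A) :=
  isClosed_tensorJacobsonRadical

theorem IsSummableFamily.sub {M N : ι → A} (hM : IsSummableFamily M) (hN : IsSummableFamily N) :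
    IsSummableFamily fun i => M i - N i := by
  refine lt_of_le_of_lt (ENNReal.tsum_le_tsum fun i => enorm_sub_le) ?_
  rw [ENNReal.tsum_add]
  exact ENNReal.add_lt_top.2 ⟨hM, hN⟩

/-- The tensor radius may be computed modulo the tensor radical. -/
theorem tensorRadius_le_quotientMap {M : ι → A} (hM : IsSummableFamily M) :
    tensorRadius M ≤ tensorRadius ((tensorJacobsonRadical A).quotientMap ∘ M) := by
  refine tensorRadius_le_of_smul fun c hc hr => ?_
  rw [smul_comp] at hr
  have hcM := isSummableFamily_smul M c hM
  obtain ⟨n, L, hL, hd⟩ := AlgIdeal.exists_pow_small_lift _ hcM hr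
  have hLs : IsSummableFamily L := hL.trans ENNReal.one_lt_top
  refine tensorRadius_le_one_of_familyPow n ?_
  -- Some power of the family is a family in the radical plus one of norm below 1.
  have heq : familyPow (c • M) n = fun p => (familyPow (c • M) n p - L p) + L p := by
    funext p
    exact (sub_add_cancel _ _).symm
  have hW : IsSummableFamily (familyPow (c • M) n) := familyNorm_pow_lt_top _ hcM n
  rw [heq]
  exact ((tensorRadius_add_le_of_mem (hW.sub hLs) hLs hd).trans
    (tensorRadius_le_familyNorm L)).trans hL.le

/-- A family whose products start as those of a family of norm less than one. -/
theorem tensorRadius_le_one_of_mul_eq {V L : ι → A} (hV : IsSummableFamily V)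
    (hL : familyNorm L < 1) (h : ∀ i j, V i * V j = L i * V j) : tensorRadius V ≤ 1 := by
  have hmul : ∀ n i p, V i * familyPow V n p = L i * familyPow V n p := by
    intro n i p
    cases n with
    | zero => exact h i p
    | succ n =>
      change V i * (V p.1 * _) = L i * (V p.1 * _)
      rw [← mul_assoc, h, mul_assoc]
  -- In a word, every letter but the last can be exchanged for the corresponding member of `L`.
  have hpow : ∀ n, familyNorm (familyPow V n) ≤ familyNorm L ^ n * familyNorm V := by
    intro n
    induction n with
    | zero => rw [pow_zero, one_mul]; exact le_rfl
    | succ n ih =>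
      have heq : familyPow V (n + 1) = familyMul L (familyPow V n) :=
        funext fun p => hmul n p.1 p.2
      rw [heq, pow_succ', mul_assoc]
      exact (familyNorm_mul_le _ _).trans (by gcongr)
  refine tensorRadius_le_one V ((ENNReal.tsum_le_tsum hpow).trans_lt ?_)
  rw [ENNReal.tsum_mul_right, ENNReal.tsum_geometric]
  exact ENNReal.mul_lt_top (ENNReal.inv_lt_top.2 (tsub_pos_of_lt hL)) hV

/-- If an element annihilates a closed ideal modulo the tensor radical and belongs to the tensor
radical modulo this ideal, then it belongs to the tensor radical. -/
theorem mem_tensorJacobsonRadical_of_quotient (Z : AlgIdeal A) [IsClosed (Z.toSubmodule : Set A)]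
    {y : A} (hZ : ∀ z ∈ Z, z * y ∈ tensorJacobsonRadical A)
    (hy : Z.quotientMap y ∈ tensorJacobsonRadical Z.Quotient) : y ∈ tensorJacobsonRadical A := by
  refine isTensorRadicalElement_of_tensorRadius_mul_left fun ι M hM => ?_
  refine tensorRadius_eq_zero_of_smul fun c hc => ?_
  have hcM := isSummableFamily_smul M c hM
  have heq : (c • fun i => y * M i) = fun i => y * (c • M) i := by
    funext i
    exact (mul_smul_comm c y (M i)).symm
  rw [heq]
  set K : ι → A := fun i => y * (c • M) i with hK
  have hKs : IsSummableFamily K := hcM.mul_left y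
  have h0 : tensorRadius (Z.quotientMap ∘ K) < 1 := by
    have h1 := IsTensorRadicalElement.tensorRadius_mul_left hy (hcM.quotientMap Z)
    have h2 : Z.quotientMap ∘ K =
        fun i => Z.quotientMap y * (Z.quotientMap ∘ (c • M)) i := by
      funext i
      exact map_mul Z.quotientMap _ _
    rw [h2, h1]
    exact zero_lt_one
  -- The radius modulo `Z` is zero, so some power of `K` differs from a family of norm below 1 only
  -- by members of `Z`.
  obtain ⟨n, L, hL, hd⟩ := Z.exists_pow_small_lift hKs h0
  refine tensorRadius_le_one_of_familyPow n ?_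
  have hW : IsSummableFamily (familyPow K n) := familyNorm_pow_lt_top _ hKs n
  refine (tensorRadius_le_quotientMap hW).trans ?_
  set q := (tensorJacobsonRadical A).quotientMap with hq
  refine tensorRadius_le_one_of_mul_eq (L := q ∘ L) (hW.quotientMap _)
    (lt_of_le_of_lt (ENNReal.tsum_le_tsum fun _ => AlgIdeal.enorm_quotientMap_le _ _) hL) ?_
  intro i j
  change q (familyPow K n i) * q (familyPow K n j) = q (L i) * q (familyPow K n j)
  rw [← map_mul, ← map_mul, AlgIdeal.quotientMap_eq_iff, ← sub_mul]
  -- Every word in `K` begins with `y`, so the difference in `Z` annihilates the next word modulo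
  -- the radical. In the quotient, the power of `K` and `L` thus have the same products with members
  -- of that power.
  obtain ⟨w, hw⟩ : ∃ w, familyPow K n j = y * w := by
    cases n with
    | zero => exact ⟨_, rfl⟩
    | succ n => exact ⟨_, mul_assoc _ _ _⟩
  rw [hw, ← mul_assoc]
  exact (tensorJacobsonRadical A).mul_mem_right _ (hZ _ (hd i))

end Radical

/-! ### Commutative ideals modulo a semiprime ideal. -/

namespace AlgIdeal

section Semiprime

variable {A : Type u} [NonUnitalRing A] [Module ℂ A] {R : AlgIdeal A}

protected theorem add_mem {x y : A} (hx : x ∈ R) (hy : y ∈ R) : x + y ∈ R :=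
  R.toSubmodule.add_mem hx hy

protected theorem sub_mem {x y : A} (hx : x ∈ R) (hy : y ∈ R) : x - y ∈ R :=
  R.toSubmodule.sub_mem hx hy

/-- An element that is central modulo `R`, and generates an ideal of such elements. -/
def IsCentralMod (R : AlgIdeal A) (x : A) : Prop :=
  (∀ a, x * a - a * x ∈ R) ∧ ∀ a b, x * (a * b - b * a) ∈ R

/-- If `A / R` is semiprime, then an ideal that is commutative modulo `R` is central modulo `R`. -/
theorem IsCommutativeMod.isCentralMod (hR : ∀ x, (∀ c, x * c * x ∈ R) → x ∈ R) {J : AlgIdeal A}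
    (hJ : J.IsCommutativeMod R) {x : A} (hx : x ∈ J) : R.IsCentralMod x := by
  have central : ∀ x ∈ J, ∀ a, x * a - a * x ∈ R := by
    intro x hx a
    -- With `[s, t] = st - ts` and `u = [x, a] c` in `J`, one has `u [x, a] = [u, x] a - [u a, x]`:
    -- two commutators of elements of `J`, up to a factor.
    refine hR _ fun c => ?_
    have hu : (x * a - a * x) * c ∈ J :=
      J.mul_mem_right _ (J.sub_mem (J.mul_mem_right a hx) (J.mul_mem_left a hx))
    set u := (x * a - a * x) * c
    have h : u * (x * a - a * x) = (u * x - x * u) * a - (u * a * x - x * (u * a)) := by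
      noncomm_ring
    rw [h]
    exact AlgIdeal.sub_mem (R.mul_mem_right a (hJ u hu x hx)) (hJ _ (J.mul_mem_right a hu) x hx)
  refine ⟨central x hx, fun a b => ?_⟩
  have h : x * (a * b - b * a) = (x * a * b - b * (x * a)) - (x * b - b * x) * a := by
    noncomm_ring
  rw [h]
  exact AlgIdeal.sub_mem (central _ (J.mul_mem_right a hx) b) (R.mul_mem_right a (central x hx b))

/-- The ideal of all elements that are central modulo `R` together with the ideal they generate. -/
def centralIdeal [IsScalarTower ℂ A A] [SMulCommClass ℂ A A] (R : AlgIdeal A) : AlgIdeal A where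
  carrier := {x | R.IsCentralMod x}
  zero_mem' := by
    refine ⟨fun a => ?_, fun a b => ?_⟩
    · rw [zero_mul, mul_zero, sub_zero]; exact R.zero_mem'
    · rw [zero_mul]; exact R.zero_mem'
  add_mem' {x y} hx hy := by
    refine ⟨fun a => ?_, fun a b => ?_⟩
    · have h : (x + y) * a - a * (x + y) = (x * a - a * x) + (y * a - a * y) := by noncomm_ring
      rw [h]
      exact AlgIdeal.add_mem (hx.1 a) (hy.1 a)
    · rw [add_mul]
      exact AlgIdeal.add_mem (hx.2 a b) (hy.2 a b)
  smul_mem' c x hx := by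
    refine ⟨fun a => ?_, fun a b => ?_⟩
    · rw [smul_mul_assoc, mul_smul_comm, ← smul_sub]
      exact R.toSubmodule.smul_mem c (hx.1 a)
    · rw [smul_mul_assoc]
      exact R.toSubmodule.smul_mem c (hx.2 a b)
  mul_mem_left c x hx := by
    refine ⟨fun a => ?_, fun a b => ?_⟩
    · have h : c * x * a - a * (c * x) = c * (x * a - a * x) + x * (c * a - a * c) -
          (x * (c * a - a * c) - (c * a - a * c) * x) := by
        noncomm_ring
      rw [h]
      exact AlgIdeal.sub_mem (AlgIdeal.add_mem (R.mul_mem_left c (hx.1 a)) (hx.2 c a)) (hx.1 _)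
    · rw [mul_assoc]
      exact R.mul_mem_left c (hx.2 a b)
  mul_mem_right c x hx := by
    refine ⟨fun a => ?_, fun a b => ?_⟩
    · have h : x * c * a - a * (x * c) = x * (c * a - a * c) + (x * a - a * x) * c := by
        noncomm_ring
      rw [h]
      exact AlgIdeal.add_mem (hx.2 c a) (R.mul_mem_right c (hx.1 a))
    · have h : x * c * (a * b - b * a) = (x * c - c * x) * (a * b - b * a) +
          c * (x * (a * b - b * a)) := by
        noncomm_ring
      rw [h]
      exact AlgIdeal.add_mem (R.mul_mem_right _ (hx.1 c)) (R.mul_mem_left c (hx.2 a b))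

/-- Being central modulo a semiprime ideal may be tested on an ideal that contains the element. -/
theorem IsCentralMod.of_ideal (hR : ∀ x, (∀ c, x * c * x ∈ R) → x ∈ R) {I : AlgIdeal A} {x : A}
    (hx : x ∈ I) (h1 : ∀ z ∈ I, x * z - z * x ∈ R)
    (h2 : ∀ z ∈ I, ∀ w ∈ I, x * (z * w - w * z) ∈ R) : R.IsCentralMod x := by
  -- `k c` is in `I`, so `k c k` is in `R` and semiprimeness applies. Memberships for elements of
  -- `I` can therefore be checked after left multiplication by elements of `I`.
  have hann : ∀ k ∈ I, (∀ z ∈ I, z * k ∈ R) → k ∈ R := fun k hk hzk =>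
    hR k fun c => hzk _ (I.mul_mem_right c hk)
  -- The two test elements are freed from `I` one at a time; multiplication by `z` moves the
  -- arbitrary factor `b` into the ideal as `z * b`.
  have h3 : ∀ w ∈ I, ∀ b, x * (w * b - b * w) ∈ R := by
    intro w hw b
    refine hann _ (I.mul_mem_right _ hx) fun z hz => ?_
    have h : z * (x * (w * b - b * w)) = x * (z * w - w * z) * b +
        x * (w * (z * b) - z * b * w) - (x * z - z * x) * (w * b - b * w) := by
      noncomm_ring
    rw [h]
    exact AlgIdeal.sub_mem (AlgIdeal.add_mem (R.mul_mem_right b (h2 z hz w hw))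
      (h2 w hw _ (I.mul_mem_right b hz))) (R.mul_mem_right _ (h1 z hz))
  refine ⟨fun a => ?_, fun a b => ?_⟩
  · refine hann _ (AlgIdeal.sub_mem (I.mul_mem_right a hx) (I.mul_mem_left a hx)) fun z hz => ?_
    have h : z * (x * a - a * x) = (x * (z * a) - z * a * x) - (x * z - z * x) * a := by
      noncomm_ring
    rw [h]
    exact AlgIdeal.sub_mem (h1 _ (I.mul_mem_right a hz)) (R.mul_mem_right a (h1 z hz))
  · refine hann _ (I.mul_mem_right _ hx) fun z hz => ?_
    have h : z * (x * (a * b - b * a)) = x * (z * a * b - b * (z * a)) -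
        x * (z * b - b * z) * a - (x * z - z * x) * (a * b - b * a) := by
      noncomm_ring
    rw [h]
    exact AlgIdeal.sub_mem (AlgIdeal.sub_mem (h3 _ (I.mul_mem_right a hz) b)
      (R.mul_mem_right a (h3 z hz b))) (R.mul_mem_right _ (h1 z hz))

/-- The preimage of the sum of all commutative ideals of the semiprime algebra `A / R` consists of
the elements that are central modulo `R`. -/
theorem comap_sumCommIdeals [IsScalarTower ℂ A A] [SMulCommClass ℂ A A]
    (hR : ∀ x, (∀ c, x * c * x ∈ R) → x ∈ R) :
    (sumCommIdeals R.Quotient).comap R.quotientMap = R.centralIdeal := by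
  refine SetLike.ext fun x => ⟨fun hx => ?_, fun hx => ?_⟩
  · have key : ∀ y ∈ sumCommIdeals R.Quotient, ∀ x, R.quotientMap x = y → x ∈ R.centralIdeal := by
      intro y hy
      refine Submodule.iSup_induction
        (fun J : {J : AlgIdeal R.Quotient // J.IsCommutative} => J.1.toSubmodule)
        (motive := fun y => ∀ x, R.quotientMap x = y → x ∈ R.centralIdeal) hy ?_ ?_ ?_
      · rintro ⟨J, hJ⟩ y hy x rfl
        refine IsCommutativeMod.isCentralMod (J := J.comap R.quotientMap) hR ?_ hy
        intro a ha b hb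
        rw [← quotientMap_eq_iff, map_mul, map_mul]
        exact hJ _ ha _ hb
      · intro x hx
        have hxR : x ∈ R := by
          rwa [← map_zero R.quotientMap, quotientMap_eq_iff, sub_zero] at hx
        exact ⟨fun a => AlgIdeal.sub_mem (R.mul_mem_right a hxR) (R.mul_mem_left a hxR),
          fun a b => R.mul_mem_right _ hxR⟩
      · intro y z hy hz x hx
        obtain ⟨y', rfl⟩ := Submodule.Quotient.mk_surjective R.toSubmodule y
        rw [← sub_add_cancel x y', add_comm]
        refine AlgIdeal.add_mem (hy y' rfl) (hz _ ?_)
        rw [map_sub, hx]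
        exact add_sub_cancel_left _ _
    exact key _ hx x rfl
  -- Conversely, the image of the central ideal in the quotient is itself one of the commutative
  -- ideals being summed.
  · let J : AlgIdeal R.Quotient :=
      { toSubmodule := R.centralIdeal.toSubmodule.map R.toSubmodule.mkQ
        mul_mem_left := by
          rintro a _ ⟨y, hy, rfl⟩
          obtain ⟨a, rfl⟩ := Submodule.Quotient.mk_surjective R.toSubmodule a
          exact ⟨a * y, R.centralIdeal.mul_mem_left a hy, rfl⟩
        mul_mem_right := by
          rintro a _ ⟨y, hy, rfl⟩
          obtain ⟨a, rfl⟩ := Submodule.Quotient.mk_surjective R.toSubmodule a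
          exact ⟨y * a, R.centralIdeal.mul_mem_right a hy, rfl⟩ }
    have hJ : J.IsCommutative := by
      rintro _ ⟨y, hy, rfl⟩ _ ⟨z, -, rfl⟩
      exact quotientMap_eq_iff.2 (hy.1 z)
    exact Submodule.mem_iSup_of_mem
      (p := fun J : {J : AlgIdeal R.Quotient // J.IsCommutative} => J.1.toSubmodule)
      ⟨J, hJ⟩ ⟨x, hx, rfl⟩

end Semiprime

end AlgIdeal

/-! ### The radical axioms for the centralization. -/

section Centralization

variable {A : Type u} [NonUnitalNormedRing A] [NormedSpace ℂ A] [IsScalarTower ℂ A A]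
  [SMulCommClass ℂ A A] {B : Type u} [NonUnitalNormedRing B] [NormedSpace ℂ B]
  [IsScalarTower ℂ B B] [SMulCommClass ℂ B B]

theorem centralization_eq :
    tensorJacobsonRadical.centralization A = (tensorJacobsonRadical A).centralIdeal :=
  AlgIdeal.comap_sumCommIdeals fun _ => mem_tensorJacobsonRadical_of_mul_mul_mem

theorem mem_centralization {x : A} : x ∈ tensorJacobsonRadical.centralization A ↔
    (tensorJacobsonRadical A).IsCentralMod x := by
  rw [centralization_eq]
  rfl

theorem isGreatest_centralization :
    IsGreatest {J : AlgIdeal A | J.IsCommutativeMod (tensorJacobsonRadical A)}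
      (tensorJacobsonRadical.centralization A) :=
  ⟨fun _ hx y _ => (mem_centralization.1 hx).1 y, fun _ hJ _ hx => mem_centralization.2
    (AlgIdeal.IsCommutativeMod.isCentralMod
      (fun _ => mem_tensorJacobsonRadical_of_mul_mul_mem) hJ hx)⟩

/-- Both conditions on `x` are preimages of the closed tensor radical under continuous maps. -/
theorem isClosed_centralization :
    IsClosed ((tensorJacobsonRadical.centralization A).toSubmodule : Set A) := by
  have h : ((tensorJacobsonRadical.centralization A).toSubmodule : Set A) =
      (⋂ a, {x | x * a - a * x ∈ ((tensorJacobsonRadical A).toSubmodule : Set A)}) ∩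
      ⋂ a, ⋂ b, {x | x * (a * b - b * a) ∈ ((tensorJacobsonRadical A).toSubmodule : Set A)} := by
    ext x
    simp only [Set.mem_inter_iff, Set.mem_iInter, Set.mem_ofPred_eq]
    exact mem_centralization
  rw [h]
  refine (isClosed_iInter fun a => ?_).inter (isClosed_iInter fun a => isClosed_iInter fun b => ?_)
  · exact isClosed_tensorJacobsonRadical.preimage (by fun_prop)
  · exact isClosed_tensorJacobsonRadical.preimage (by fun_prop)

theorem map_mem_centralization (f : A →ₙₐ[ℂ] B) (hc : Continuous f) (ho : IsOpenMap f)
    (hs : Function.Surjective f) {x : A} (hx : x ∈ tensorJacobsonRadical.centralization A) :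
    f x ∈ tensorJacobsonRadical.centralization B := by
  rw [mem_centralization] at hx ⊢
  constructor
  · intro a
    obtain ⟨a, rfl⟩ := hs a
    simpa using map_mem_tensorJacobsonRadical_of_isOpenMap f hc ho (hx.1 a)
  · intro a b
    obtain ⟨a, rfl⟩ := hs a
    obtain ⟨b, rfl⟩ := hs b
    simpa using map_mem_tensorJacobsonRadical_of_isOpenMap f hc ho (hx.2 a b)

/-- The elements `xa - ax` and `x(ab - ba)` lie in the tensor radical modulo the centralization,
which annihilates them from the left modulo the tensor radical because it kills commutators. The
extension lemma `mem_tensorJacobsonRadical_of_quotient` then applies. -/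
theorem mem_centralization_of_quotient
    [IsClosed ((tensorJacobsonRadical.centralization A).toSubmodule : Set A)] {x : A}
    (hx : (tensorJacobsonRadical.centralization A).quotientMap x ∈
      tensorJacobsonRadical.centralization (tensorJacobsonRadical.centralization A).Quotient) :
    x ∈ tensorJacobsonRadical.centralization A := by
  have hq := mem_centralization.1 hx
  have hZ : ∀ z ∈ tensorJacobsonRadical.centralization A,
      (tensorJacobsonRadical A).IsCentralMod z := fun _ => mem_centralization.1
  set Z := tensorJacobsonRadical.centralization A
  refine mem_centralization.2 ⟨fun a => ?_, fun a b => ?_⟩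
  · refine mem_tensorJacobsonRadical_of_quotient Z (fun z hz => (hZ z hz).2 x a) ?_
    simpa using hq.1 (Z.quotientMap a)
  · refine mem_tensorJacobsonRadical_of_quotient Z (fun z hz => ?_) ?_
    -- `z * x` is again in the ideal `Z`, so it kills the commutator.
    · rw [← mul_assoc]
      exact (hZ _ (Z.mul_mem_right x hz)).2 a b
    · simpa using hq.2 (Z.quotientMap a) (Z.quotientMap b)

theorem isHereditary_centralization : tensorJacobsonRadical.{u}.centralization.IsHereditary := by
  intro A _ _ _ _ I x
  rw [mem_centralization, mem_centralization]
  have h1 : ∀ z : I.toSubalgebra, x * z - z * x ∈ tensorJacobsonRadical I.toSubalgebra ↔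
      (x : A) * z - z * x ∈ tensorJacobsonRadical A := fun z => mem_tensorJacobsonRadical_ideal I
  have h2 : ∀ z w : I.toSubalgebra,
      x * (z * w - w * z) ∈ tensorJacobsonRadical I.toSubalgebra ↔
        (x : A) * (z * w - w * z) ∈ tensorJacobsonRadical A :=
    fun z w => mem_tensorJacobsonRadical_ideal I
  refine ⟨fun hx => ?_, fun hx => ⟨fun a => (h1 a).2 (hx.1 a), fun a b => (h2 a b).2 (hx.2 a b)⟩⟩
  exact AlgIdeal.IsCentralMod.of_ideal (fun _ => mem_tensorJacobsonRadical_of_mul_mul_mem) x.2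
    (fun z hz => (h1 ⟨z, hz⟩).1 (hx.1 _)) fun z hz w hw => (h2 ⟨z, hz⟩ ⟨w, hw⟩).1 (hx.2 _ _)

theorem isTopologicalRadical_centralization :
    tensorJacobsonRadical.{u}.centralization.IsTopologicalRadical where
  isClosed A _ _ _ _ := isClosed_centralization
  map_le A B _ _ _ _ _ _ _ _ f hc ho hs x hx := map_mem_centralization f hc ho hs hx
  quotient A _ _ _ _ _ := by
    refine SetLike.ext fun y => ⟨fun hy => ?_, fun hy => ?_⟩
    · obtain ⟨x, rfl⟩ := AlgIdeal.quotientMap_surjective y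
      exact AlgIdeal.quotientMap_eq_zero_iff.2 (mem_centralization_of_quotient hy)
    · have h0 : y = 0 := hy
      rw [h0]
      exact Submodule.zero_mem (AlgIdeal.toSubmodule _)
  idem A _ _ _ _ := SetLike.ext fun x =>
    ⟨fun _ => trivial, fun _ => (isHereditary_centralization A _ x).2 x.2⟩
  ideal A _ _ _ _ I := by
    refine ⟨{ toSubmodule := I.toSubmodule ⊓ (tensorJacobsonRadical.centralization A).toSubmodule
              mul_mem_left := fun a _ hx => ⟨I.mul_mem_left a hx.1, AlgIdeal.mul_mem_left _ a hx.2⟩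
              mul_mem_right := fun a _ hx =>
                ⟨I.mul_mem_right a hx.1, AlgIdeal.mul_mem_right _ a hx.2⟩ }, ?_, fun _ hx => hx.2⟩
    ext x
    constructor
    · exact fun hx => ⟨⟨x, hx.1⟩, (isHereditary_centralization A I ⟨x, hx.1⟩).2 hx.2, rfl⟩
    · rintro ⟨y, hy, rfl⟩
      exact ⟨y.2, (isHereditary_centralization A I y).1 hy⟩

/-- Elements of a subalgebra that lie in the tensor radical of the whole algebra lie in that of the
subalgebra, so both conditions restrict. -/
theorem isUniform_centralization : tensorJacobsonRadical.{u}.centralization.IsUniform := by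
  intro A _ _ _ _ S hA
  have h : ∀ x : A, (tensorJacobsonRadical A).IsCentralMod x := fun x =>
    mem_centralization.1 (hA ▸ trivial)
  exact SetLike.ext fun x => ⟨fun _ => trivial, fun _ => mem_centralization.2
    ⟨fun a => mem_tensorJacobsonRadical_subalgebra S ((h x).1 a),
      fun a b => mem_tensorJacobsonRadical_subalgebra S ((h x).2 a b)⟩⟩

/-- Towards the completion, the conditions extend from the dense image of `A` because the tensor
radical is closed; the other direction tests them on elements of `A` only. -/
theorem centralization_eq_regularization :
    tensorJacobsonRadical.{u}.centralization = tensorJacobsonRadical.centralization.regularization := by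
  funext A _ _ _ _
  refine SetLike.ext fun x => ?_
  change _ ↔ CompletionAlg.embedding A x ∈ tensorJacobsonRadical.centralization (CompletionAlg A)
  rw [mem_centralization, mem_centralization]
  have hcl := isClosed_tensorJacobsonRadical (A := CompletionAlg A)
  refine ⟨fun hx => ⟨fun a => ?_, fun a b => ?_⟩, fun hx => ⟨fun a => ?_, fun a b => ?_⟩⟩
  · refine CompletionAlg.denseRange_coe.induction_on (p := fun a => _ * a - a * _ ∈ _) a
      (hcl.preimage (f := fun a => CompletionAlg.embedding A x * a - a * CompletionAlg.embedding A x)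
        (by fun_prop)) fun a => ?_
    have h := embedding_mem_tensorJacobsonRadical.2 (hx.1 a)
    rw [map_sub, map_mul, map_mul] at h
    exact h
  · refine CompletionAlg.denseRange_coe.induction_on₂ (p := fun a b => _ * (a * b - b * a) ∈ _)
      (hcl.preimage (f := fun p : CompletionAlg A × CompletionAlg A =>
        CompletionAlg.embedding A x * (p.1 * p.2 - p.2 * p.1)) (by fun_prop)) (fun a b => ?_) a b
    have h := embedding_mem_tensorJacobsonRadical.2 (hx.2 a b)
    rw [map_mul, map_sub, map_mul, map_mul] at h
    exact h
  · refine embedding_mem_tensorJacobsonRadical.1 ?_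
    simpa using hx.1 (CompletionAlg.embedding A a)
  · refine embedding_mem_tensorJacobsonRadical.1 ?_
    simpa using hx.2 (CompletionAlg.embedding A a) (CompletionAlg.embedding A b)

end Centralization

end NormedRadical

theorem mainTheorem10 :
    (NormedRadical.tensorJacobsonRadical.{u}.centralization).IsTopologicalRadical ∧
    (NormedRadical.tensorJacobsonRadical.{u}.centralization).IsUniform ∧
    (NormedRadical.tensorJacobsonRadical.{u}.centralization).IsRegular ∧
    ∀ (A : Type u) [NonUnitalNormedRing A] [NormedSpace ℂ A] [IsScalarTower ℂ A A]
      [SMulCommClass ℂ A A],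
      IsGreatest {J : NormedRadical.AlgIdeal A |
          J.IsCommutativeMod (NormedRadical.tensorJacobsonRadical A)}
        (NormedRadical.tensorJacobsonRadical.centralization A) :=
  ⟨NormedRadical.isTopologicalRadical_centralization, NormedRadical.isUniform_centralization,
    ⟨NormedRadical.isTopologicalRadical_centralization,
      NormedRadical.isHereditary_centralization, NormedRadical.centralization_eq_regularization⟩,
    fun _ _ _ _ _ => NormedRadical.isGreatest_centralization⟩
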